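/- **Setting.** Let $n,p\ge 1$, $\tau\ge 0$ be integers, let $\mu,\omega,L,M>0$ be reals, $\kappa=\omega/\mu$, and let $f=\sum_{i=1}^p f_i$ with $f_i:\mathbb R^n\to\mathbb R$. Suppose that each $f_i$ is twice differentiable with $\mu I\preceq\nabla^2 f_i(x)\preceq\omega I$ for all $x$ and $\|\nabla^2 f_i(y)-\nabla^2 f_i(x)\|\le L\|y-x\|$ for all $x,y$ (spectral norm), and that $M$ is a constant of strong self-concordance of each $f_i$, i.e. $\nabla^2 f_i(y)-\nabla^2 f_i(x)\preceq M\|y-x\|_{\nabla^2 f_i(z)}\nabla^2 f_i(w)$ for all $x,y,z,w$. Here $\|h\|_A=\langle Ah,h\rangle^{1/2}$ and $\|h\|_A^*=\langle A^{-1}h,h\rangle^{1/2}$. Assume $n\kappa>1$ (i.e. exclude only $n=\kappa=1$), and put $$\rho=1-\frac1{n\kappa}\in(0,1),\quad \varepsilon_0=\frac1{2\kappa-1},\quad \sigma_\tau=\rho^\tau\varepsilon_0+n\sqrt p,\quad \bar\Phi_0=\varepsilon_0+\frac{n\ln 2}{12n+2},$$ $$c_{\tau,\varepsilon_0}=-\frac{\sigma_\tau}{\sigma_\tau+n\sqrt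 p}+\frac{\sqrt{\rho\sigma_\tau^2+(\sigma_\tau+n\sqrt p)(1-\rho^{\tau+1})\varepsilon_0}}{\sqrt\rho\,(\sigma_\tau+n\sqrt p)}.$$ Let $\beta(x)=L\|\nabla f(x)\|/(2p\mu^2)$ and $\lambda(x)=(\nabla f(x)^{\mathsf T}\nabla^2 f(x)^{-1}\nabla f(x))^{1/2}$. **Updates.** For a vector $u$ let $$\mathrm{SR1}(G,A,u)=G-\frac{(G-A)uu^{\mathsf T}(G-A)}{\langle (G-A)u,u\rangle}\quad(\text{and } =G \text{ if } Gu=Au),$$ $$\mathrm{DFP}(G,A,u)=G-\frac{Auu^{\mathsf T}G+Guu^{\mathsf T}A}{\langle Au,u\rangle}+\Big(\frac{\langle Gu,u\rangle}{\langle Au,u\rangle}+1\Big)\frac{Auu^{\mathsf T}A}{\langle Au,u\rangle}.$$ Let $\mathrm{gBroyd}(G,A)=\phi\,\mathrm{DFP}(G,A,u)+(1-\phi)\,\mathrm{SR1}(G,A,u)$, where $u$ maximizes $\langle Gu,u\rangle/\langle Au,u\rangle$ over the standard unit vectors $e_1,\dots,e_n$, and $\phi\in[0,1]$ and the choice among maximizers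 are arbitrary at every call; $\mathrm{gBroyd}^{(\tau)}$ is the $\tau$-fold composition of $\mathrm{gBroyd}(\cdot,A)$. **DAGQN.** Given $x^0$ and $G_1^0,\dots,G_p^0$, iterate for $k\ge0$, with $G^k=\sum_i G_i^k$: $$x^{k+1}=x^k-\alpha(x^k)(G^k)^{-1}\nabla f(x^k),\qquad \alpha(x^k)=\min\{\alpha_\tau(x^k),\,1/(4\beta(x^k)),\,1\},\qquad \alpha_\tau(x^k)=\frac{c_{\tau,\varepsilon_0}}{M\|\nabla f(x^k)\|_{G^k}^*},$$ $$\underline G_i^k=\mathrm{gBroyd}^{(\tau)}(G_i^k,\nabla^2 f_i(x^k)),\qquad G_i^{k+1}=\mathrm{gBroyd}\big((1+M r_i^{k+1})\underline G_i^k,\nabla^2 f_i(x^{k+1})\big),\qquad r_i^{k+1}=\|x^{k+1}-x^k\|_{\nabla^2 f_i(x^k)}.$$ Put $\bar\alpha_\tau(x^k)=\min\{\alpha_\tau(x^k),1\}$. (If $\nabla f(x^k)=0$ then $x^{k+1}=x^k$, and the value given to the stepsize is immaterial.) **Theorem (explicit non-asymptotic bounds of DAGQN).** Suppose that $G_i^0\succeq\nabla^2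 f_i(x^0)$ for each $i$ and that $$\Delta_{\nabla^2 f(x^0)}(G^0):=\sum_{i=1}^p \mathrm{Trace}\big(\nabla^2 f_i(x^0)^{-1}(G_i^0-\nabla^2 f_i(x^0))\big)\le\varepsilon_0 .$$ (a) (Global convergence) For every $k\ge0$, $$\beta(x^{k+1})\le\begin{cases}\beta(x^k)-1/16,&\text{if }\beta(x^k)>1/(4\bar\alpha_\tau(x^k)),\\(1-\bar\alpha_\tau(x^k)/4)\,\beta(x^k),&\text{otherwise.}\end{cases}$$ (b) (Local convergence) Suppose that $\|\nabla f(x^0)\|\le\min\{\sqrt{p\mu}\,c_{\tau,\varepsilon_0}/M,\;p\mu^2/(2L)\}$. If $\sqrt p M\lambda(x^0)\le 1/4$, then $\lambda(x^{k+1})\le\frac34\lambda(x^k)$ for every $k\ge0$. If moreover $n\ge2$ and $\sqrt p M\lambda(x^0)\le\dfrac{\ln 2}{8(6n+1)}$, then for every $k\ge0$ $$\lambda(x^{k+1})\le\big(\max\{\rho^{\tau+1},\tfrac34\rho\}\big)^k\,2\bar\Phi_0\,\lambda(x^k).$$ -/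

import Mathlib

noncomputable section

namespace DAGQN

/-- `n`-dimensional Euclidean space. -/
abbrev E (n : ℕ) := EuclideanSpace ℝ (Fin n)

/-- Real `n × n` matrices. -/
abbrev Mat (n : ℕ) := Matrix (Fin n) (Fin n) ℝ

/-- The matrix `A` acting on a vector of Euclidean space. -/
def act {n : ℕ} (A : Mat n) (h : E n) : E n := Matrix.toEuclideanCLM (𝕜 := ℝ) A h

/-- The Loewner order `A ⪯ B`: the matrix `B - A` is symmetric positive semidefinite. -/
def Loewner {n : ℕ} (A B : Mat n) : Prop := (B - A).PosSemidef

/-- The weighted norm `‖h‖_A = ⟨A h, h⟩^{1/2}`. -/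
def wnorm {n : ℕ} (A : Mat n) (h : E n) : ℝ := √(inner ℝ (act A h) h)

/-- The dual weighted norm `‖h‖_A^* = ⟨A⁻¹ h, h⟩^{1/2}`. -/
def dualNorm {n : ℕ} (A : Mat n) (h : E n) : ℝ := wnorm A⁻¹ h

/-- The Hessian matrix: the matrix of the derivative of the gradient map. -/
def hess {n : ℕ} (f : E n → ℝ) (x : E n) : Mat n :=
  (Matrix.toEuclideanCLM (n := Fin n) (𝕜 := ℝ)).symm (fderiv ℝ (gradient f) x)

/-- `f` is twice differentiable, `μ I ⪯ ∇²f(x) ⪯ ω I` for all `x`, and the Hessian is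
`L`-Lipschitz in the operator (spectral) norm. -/
structure Regular {n : ℕ} (μ ω L : ℝ) (f : E n → ℝ) : Prop where
  differentiable : Differentiable ℝ f
  differentiable_gradient : Differentiable ℝ (gradient f)
  lower : ∀ x, Loewner (μ • (1 : Mat n)) (hess f x)
  upper : ∀ x, Loewner (hess f x) (ω • (1 : Mat n))
  lipschitz : ∀ x y,
    ‖Matrix.toEuclideanCLM (𝕜 := ℝ) (hess f y - hess f x)‖ ≤ L * ‖y - x‖

/-- Strong self-concordance with constant `M`. -/
def StronglySelfConcordant {n : ℕ} (M : ℝ) (f : E n → ℝ) : Prop :=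
  ∀ x y z w : E n,
    Loewner (hess f y - hess f x) ((M * wnorm (hess f z) (y - x)) • hess f w)

/-! ### Greedy quasi-Newton updates -/

/-- The quadratic form `⟨A u, u⟩`. -/
def quad {n : ℕ} (A : Mat n) (u : Fin n → ℝ) : ℝ := dotProduct (A.mulVec u) u

/-- The SR1 update. If `G u = A u`, the subtracted term is zero and the value is `G`. -/
def SR1 {n : ℕ} (G A : Mat n) (u : Fin n → ℝ) : Mat n :=
  G - (quad (G - A) u)⁻¹ • ((G - A) * Matrix.vecMulVec u u * (G - A))

/-- The DFP update. -/
def DFP {n : ℕ} (G A : Mat n) (u : Fin n → ℝ) : Mat n :=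
  G - (quad A u)⁻¹ • (A * Matrix.vecMulVec u u * G + G * Matrix.vecMulVec u u * A)
    + ((quad G u / quad A u + 1) * (quad A u)⁻¹) • (A * Matrix.vecMulVec u u * A)

/-- The update of the Broyden family with parameter `φ`. -/
def Broyd {n : ℕ} (φ : ℝ) (G A : Mat n) (u : Fin n → ℝ) : Mat n :=
  φ • DFP G A u + (1 - φ) • SR1 G A u

/-- The standard unit vector `e_j`. -/
def unitVec {n : ℕ} (j : Fin n) : Fin n → ℝ := Pi.single j 1

/-- `e_j` maximizes `⟨G u, u⟩ / ⟨A u, u⟩` over the standard unit vectors `u`. -/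
def IsGreedy {n : ℕ} (G A : Mat n) (j : Fin n) : Prop :=
  ∀ i : Fin n, quad G (unitVec i) / quad A (unitVec i) ≤ quad G (unitVec j) / quad A (unitVec j)

/-- `G'` is a possible value of `gBroyd(G, A)`: a maximizing unit vector and a parameter
`φ ∈ [0, 1]` may be chosen freely at every call. -/
def IsGBroyd {n : ℕ} (G A G' : Mat n) : Prop :=
  ∃ j : Fin n, IsGreedy G A j ∧ ∃ φ ∈ Set.Icc (0 : ℝ) 1, G' = Broyd φ G A (unitVec j)

/-- `G'` is a possible value of the `t`-fold composition of `gBroyd(·, A)` at `G`. -/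
def IsGBroydIter {n : ℕ} (A : Mat n) : ℕ → Mat n → Mat n → Prop
  | 0, G, G' => G' = G
  | t + 1, G, G' => ∃ H : Mat n, IsGBroydIter A t G H ∧ IsGBroyd H A G'

/-- `σ_A(G) = ⟨A⁻¹, G - A⟩ = Trace(A⁻¹ (G - A))`. -/
def sigma {n : ℕ} (A G : Mat n) : ℝ := (A⁻¹ * (G - A)).trace

/-- `Δ_A(G) = ∑ᵢ σ_{Aᵢ}(Gᵢ)`, for `A = ∑ᵢ Aᵢ` and `G = ∑ᵢ Gᵢ`. -/
def Delta {n p : ℕ} (A G : Fin p → Mat n) : ℝ := ∑ i, sigma (A i) (G i)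

/-! ### Constants, stepsize and suboptimality measures -/

/-- `ρ = 1 - 1 / (n κ)`. -/
def rho (n : ℕ) (κ : ℝ) : ℝ := 1 - 1 / (n * κ)

/-- `ε₀ = 1 / (2 κ - 1)`. -/
def eps0 (κ : ℝ) : ℝ := 1 / (2 * κ - 1)

/-- `σ_τ = ρ^τ ε + n √p`. -/
def sigmaTau (n p τ : ℕ) (κ ε : ℝ) : ℝ := rho n κ ^ τ * ε + n * √p

/-- The constant `c_{τ, ε}`. -/
def cTau (n p τ : ℕ) (κ ε : ℝ) : ℝ :=
  -(sigmaTau n p τ κ ε / (sigmaTau n p τ κ ε + n * √p))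
    + √(rho n κ * sigmaTau n p τ κ ε ^ 2
          + (sigmaTau n p τ κ ε + n * √p) * (1 - rho n κ ^ (τ + 1)) * ε)
      / (√(rho n κ) * (sigmaTau n p τ κ ε + n * √p))

/-- `\bar Φ₀ = ε₀ + n ln 2 / (12 n + 2)`. -/
def Phi0 (n : ℕ) (κ : ℝ) : ℝ := eps0 κ + n * Real.log 2 / (12 * n + 2)

/-- The objective `f = ∑ᵢ fᵢ`. -/
def total {n p : ℕ} (f : Fin p → E n → ℝ) (x : E n) : ℝ := ∑ i, f i x

/-- `β(x) = L ‖∇f(x)‖ / (2 p μ²)`. -/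
def beta {n p : ℕ} (μ L : ℝ) (f : Fin p → E n → ℝ) (x : E n) : ℝ :=
  L * ‖gradient (total f) x‖ / (2 * p * μ ^ 2)

/-- `λ(x) = (∇f(x)ᵀ ∇²f(x)⁻¹ ∇f(x))^{1/2}`. -/
def lam {n p : ℕ} (f : Fin p → E n → ℝ) (x : E n) : ℝ :=
  dualNorm (hess (total f) x) (gradient (total f) x)

/-- `α_τ(x) = c_{τ, ε₀} / (M ‖∇f(x)‖_G^*)` with `κ = ω / μ`. If `∇f(x) = 0`, the informal value
is `+∞` and the value here is `0`; the direction `G⁻¹ ∇f(x)` and `β(x)` both vanish then, so that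
neither the iterates nor the bounds on `β` and `λ` depend on it. -/
def alphaTau {n p : ℕ} (τ : ℕ) (μ ω M : ℝ) (f : Fin p → E n → ℝ) (G : Mat n) (x : E n) : ℝ :=
  cTau n p τ (ω / μ) (eps0 (ω / μ)) / (M * dualNorm G (gradient (total f) x))

/-- `\bar α_τ(x) = min {α_τ(x), 1}`. -/
def alphaBar {n p : ℕ} (τ : ℕ) (μ ω M : ℝ) (f : Fin p → E n → ℝ) (G : Mat n) (x : E n) : ℝ :=
  min (alphaTau τ μ ω M f G x) 1

/-- The adaptive stepsize `α(x) = min {α_τ(x), 1 / (4 β(x)), 1}`. -/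
def stepSize {n p : ℕ} (τ : ℕ) (μ ω L M : ℝ) (f : Fin p → E n → ℝ) (G : Mat n) (x : E n) : ℝ :=
  min (alphaTau τ μ ω M f G x) (min (1 / (4 * beta μ L f x)) 1)

/-- The sequences `x^k` and `G_i^k` (written `G k i`) are generated by the distributed adaptive
greedy quasi-Newton method with parameters `τ, μ, ω, L, M`. -/
structure IsRun {n p : ℕ} (τ : ℕ) (μ ω L M : ℝ) (f : Fin p → E n → ℝ)
    (x : ℕ → E n) (G : ℕ → Fin p → Mat n) : Prop where
  /-- The master's step `x^{k+1} = x^k - α(x^k) (G^k)⁻¹ ∇f(x^k)` with `G^k = ∑ᵢ G_i^k`. -/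
  iterate : ∀ k, x (k + 1) =
    x k - stepSize τ μ ω L M f (∑ i, G k i) (x k) •
      act (∑ i, G k i)⁻¹ (gradient (total f) (x k))
  /-- Worker `i` refines `G_i^k` by `τ` greedy updates towards `∇²fᵢ(x^k)`, multiplies the result
  by `1 + M ‖x^{k+1} - x^k‖_{∇²fᵢ(x^k)}`, and makes one greedy update towards
  `∇²fᵢ(x^{k+1})`. -/
  estimate : ∀ k i, ∃ H : Mat n,
    IsGBroydIter (hess (f i) (x k)) τ (G k i) H ∧
    IsGBroyd ((1 + M * wnorm (hess (f i) (x k)) (x (k + 1) - x k)) • H)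
      (hess (f i) (x (k + 1))) (G (k + 1) i)

end DAGQN

end

open DAGQN

/-! Everything rests on the error `Δ = ∑ᵢ σ_{Aᵢ}(Gᵢ)` with `Aᵢ = ∇²fᵢ(x^k)`. If `Aᵢ ⪯ Gᵢ`, the trace
dominates the largest relative error, so `A ⪯ G ⪯ (1 + Δ) A` for the sums (`Setting.sub_le_Delta`).

A greedy update keeps `Aᵢ ⪯ Gᵢ` and multiplies `σ` by at most `ρ` (`sigma_le_of_isGBroyd`): DFP and
SR1 both remove at least the relative error along the chosen coordinate, and the best coordinate
carries a fraction `1/(nκ)` of the total. Moving `x` costs a factor `(1 + M rᵢ)²` by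
self-concordance (`worker_bounds`). The constant `c_{τ,ε₀}` is the root of the quadratic that
balances gain and loss, and `α_τ` keeps `M ‖x^{k+1} - x^k‖` in the metric of `∇²f(x^k)` below it.
Hence `Δ ≤ ε₀` persists (`Setting.approximates`).

Global part: the new gradient is `(1 - α) g + α (G - A) G⁻¹ g` plus a quadratic remainder. The
choice of `ε₀` gives `‖(G - A) G⁻¹ g‖ ≤ ‖g‖/2`, so `β' ≤ (1 - α/2) β + α² β²`, and the two regimes
follow (`adaptive_step_bounds`).

Local part: the gradient norm never grows, so the stepsize stays one (`Setting.iterate_eq`). With `m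
= √p M λ` this gives `λ' ≤ (1 + m/2)(Δ/(1 + Δ) + m/2) λ`, hence the factor `3/4`. For the fast rate,
`Δ + 4 n m` contracts by `θ (1 + (12 n + 2) m)` with `θ = max {ρ^{τ+1}, 3ρ/4}`. Since `m` is
summable, the extra factors multiply to at most `2` (`potential_bound`). -/

namespace DAGQN

/-! ### Quadratic forms, inverses and traces in the Loewner order. -/

section Loewner

open Matrix

variable {n : ℕ}

theorem posSemidef_iff_dotProduct {A : Mat n} :
    A.PosSemidef ↔ A.IsHermitian ∧ ∀ v, 0 ≤ v ⬝ᵥ A *ᵥ v := by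
  simpa using posSemidef_iff_dotProduct_mulVec (M := A)

theorem posDef_iff_dotProduct {A : Mat n} :
    A.PosDef ↔ A.IsHermitian ∧ ∀ v, v ≠ 0 → 0 < v ⬝ᵥ A *ᵥ v := by
  simpa using posDef_iff_dotProduct_mulVec (M := A)

theorem quad_eq_dotProduct (A : Mat n) (v : Fin n → ℝ) : quad A v = v ⬝ᵥ A *ᵥ v :=
  dotProduct_comm _ _

theorem quad_unitVec (A : Mat n) (i : Fin n) : quad A (unitVec i) = A i i := by
  simp [quad, unitVec]

theorem Loewner.dotProduct_le {A B : Mat n} (h : Loewner A B) (v : Fin n → ℝ) :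
    v ⬝ᵥ A *ᵥ v ≤ v ⬝ᵥ B *ᵥ v := by
  have := (posSemidef_iff_dotProduct.1 h).2 v
  rwa [sub_mulVec, dotProduct_sub, sub_nonneg] at this

theorem loewner_of_dotProduct_le {A B : Mat n} (hA : A.IsHermitian) (hB : B.IsHermitian)
    (h : ∀ v, v ⬝ᵥ A *ᵥ v ≤ v ⬝ᵥ B *ᵥ v) : Loewner A B := by
  refine posSemidef_iff_dotProduct.2 ⟨hB.sub hA, fun v => ?_⟩
  rw [sub_mulVec, dotProduct_sub]
  exact sub_nonneg.2 (h v)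

theorem Loewner.isHermitian {A B : Mat n} (h : Loewner A B) (hA : A.IsHermitian) :
    B.IsHermitian := by
  have := Matrix.PosSemidef.isHermitian h
  simpa using this.add hA

theorem Loewner.posDef {A B : Mat n} (h : Loewner A B) (hA : A.PosDef) : B.PosDef := by
  have := hA.add_posSemidef h
  rwa [add_sub_cancel] at this

theorem isHermitian_smul {A : Mat n} (hA : A.IsHermitian) (c : ℝ) : (c • A).IsHermitian := by
  rw [IsHermitian, conjTranspose_smul, hA.eq, star_trivial]

theorem posDef_smul_one {μ : ℝ} (hμ : 0 < μ) : (μ • (1 : Mat n)).PosDef :=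
  PosDef.one.smul hμ

theorem dotProduct_mulVec_comm {A : Mat n} (hA : A.IsHermitian) (v w : Fin n → ℝ) :
    v ⬝ᵥ A *ᵥ w = w ⬝ᵥ A *ᵥ v := by
  have hT : Aᵀ = A := by simpa [conjTranspose_eq_transpose_of_trivial] using hA.eq
  rw [dotProduct_mulVec, ← mulVec_transpose, hT, dotProduct_comm]

theorem mulVec_dotProduct {A : Mat n} (hA : A.IsHermitian) (v w : Fin n → ℝ) :
    (A *ᵥ v) ⬝ᵥ w = v ⬝ᵥ A *ᵥ w := by
  rw [dotProduct_comm, dotProduct_mulVec_comm hA]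

theorem dotProduct_smul_one (μ : ℝ) (v : Fin n → ℝ) :
    v ⬝ᵥ (μ • (1 : Mat n)) *ᵥ v = μ * (v ⬝ᵥ v) := by
  simp [smul_mulVec, dotProduct_smul]

theorem dotProduct_smul_mulVec (c : ℝ) (A : Mat n) (v : Fin n → ℝ) :
    v ⬝ᵥ (c • A) *ᵥ v = c * (v ⬝ᵥ A *ᵥ v) := by
  simp [smul_mulVec, dotProduct_smul]

/-- The Cauchy–Schwarz inequality for a positive semidefinite form. -/
theorem sq_dotProduct_mulVec_le {A : Mat n} (hA : A.PosSemidef) (v w : Fin n → ℝ) :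
    (v ⬝ᵥ A *ᵥ w) ^ 2 ≤ (v ⬝ᵥ A *ᵥ v) * (w ⬝ᵥ A *ᵥ w) := by
  obtain ⟨hH, hp⟩ := posSemidef_iff_dotProduct.1 hA
  have h : ∀ t : ℝ, 0 ≤ (w ⬝ᵥ A *ᵥ w) * (t * t) + (2 * (v ⬝ᵥ A *ᵥ w)) * t + v ⬝ᵥ A *ᵥ v := by
    intro t
    have := hp (v + t • w)
    simp only [mulVec_add, mulVec_smul, dotProduct_add, add_dotProduct, dotProduct_smul,
      smul_dotProduct, smul_eq_mul, dotProduct_mulVec_comm hH w v] at this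
    linarith
  have := discrim_le_zero h
  rw [discrim] at this
  linarith

theorem mulVec_inv_mulVec {A : Mat n} (hA : A.PosDef) (v : Fin n → ℝ) :
    A *ᵥ (A⁻¹ *ᵥ v) = v := by
  rw [mulVec_mulVec, mul_nonsing_inv _ ((isUnit_iff_isUnit_det _).1 hA.isUnit), one_mulVec]

theorem inv_mulVec_mulVec {A : Mat n} (hA : A.PosDef) (v : Fin n → ℝ) :
    A⁻¹ *ᵥ (A *ᵥ v) = v := by
  rw [mulVec_mulVec, nonsing_inv_mul _ ((isUnit_iff_isUnit_det _).1 hA.isUnit), one_mulVec]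

theorem dotProduct_mulVec_nonneg {A : Mat n} (hA : A.PosSemidef) (v : Fin n → ℝ) :
    0 ≤ v ⬝ᵥ A *ᵥ v :=
  (posSemidef_iff_dotProduct.1 hA).2 v

theorem mulVec_dotProduct_inv {A : Mat n} (hA : A.PosDef) (v : Fin n → ℝ) :
    (A *ᵥ v) ⬝ᵥ A⁻¹ *ᵥ (A *ᵥ v) = v ⬝ᵥ A *ᵥ v := by
  rw [inv_mulVec_mulVec hA, dotProduct_comm]

/-- The Cauchy–Schwarz inequality for a weighted norm and its dual. -/
theorem sq_dotProduct_le_inv {A : Mat n} (hA : A.PosDef) (g v : Fin n → ℝ) :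
    (g ⬝ᵥ v) ^ 2 ≤ (g ⬝ᵥ A⁻¹ *ᵥ g) * (v ⬝ᵥ A *ᵥ v) := by
  have h := sq_dotProduct_mulVec_le hA.posSemidef v (A⁻¹ *ᵥ g)
  rw [mulVec_inv_mulVec hA, dotProduct_comm v g, dotProduct_comm (A⁻¹ *ᵥ g) g] at h
  linarith

/-- Testing at `v = A⁻¹ g` gives `q² ≤ C q` for the dual value `q`. This converse of Cauchy–Schwarz
is how dual norms are bounded throughout. -/
theorem dotProduct_inv_le {A : Mat n} (hA : A.PosDef) {g : Fin n → ℝ} {C : ℝ} (hC : 0 ≤ C)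
    (h : ∀ v, (g ⬝ᵥ v) ^ 2 ≤ C * (v ⬝ᵥ A *ᵥ v)) : g ⬝ᵥ A⁻¹ *ᵥ g ≤ C := by
  have h1 := h (A⁻¹ *ᵥ g)
  rw [mulVec_inv_mulVec hA, dotProduct_comm (A⁻¹ *ᵥ g) g] at h1
  by_contra! hlt
  nlinarith

/-- Inversion reverses the order. -/
theorem dotProduct_inv_le_mul {A B : Mat n} (hA : A.PosDef) (hB : B.PosDef) {s : ℝ} (hs : 0 ≤ s)
    (h : ∀ v, v ⬝ᵥ A *ᵥ v ≤ s * (v ⬝ᵥ B *ᵥ v)) (g : Fin n → ℝ) :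
    g ⬝ᵥ B⁻¹ *ᵥ g ≤ s * (g ⬝ᵥ A⁻¹ *ᵥ g) := by
  have h0 := dotProduct_mulVec_nonneg hA.inv.posSemidef g
  refine dotProduct_inv_le hB (mul_nonneg hs h0) fun v => ?_
  calc (g ⬝ᵥ v) ^ 2 ≤ (g ⬝ᵥ A⁻¹ *ᵥ g) * (v ⬝ᵥ A *ᵥ v) := sq_dotProduct_le_inv hA g v
    _ ≤ (g ⬝ᵥ A⁻¹ *ᵥ g) * (s * (v ⬝ᵥ B *ᵥ v)) := mul_le_mul_of_nonneg_left (h v) h0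
    _ = _ := by ring

theorem dotProduct_inv_smul_one {μ : ℝ} (hμ : 0 < μ) (g : Fin n → ℝ) :
    g ⬝ᵥ (μ • (1 : Mat n))⁻¹ *ᵥ g = μ⁻¹ * (g ⬝ᵥ g) := by
  have h : (μ • (1 : Mat n))⁻¹ = μ⁻¹ • 1 := by
    refine inv_eq_left_inv ?_
    simp [smul_smul, hμ.ne']
  rw [h, dotProduct_smul_one]

theorem dotProduct_inv_le_of_lower {A : Mat n} {μ : ℝ} (hμ : 0 < μ)
    (h : Loewner (μ • (1 : Mat n)) A) (g : Fin n → ℝ) :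
    g ⬝ᵥ A⁻¹ *ᵥ g ≤ μ⁻¹ * (g ⬝ᵥ g) := by
  have := dotProduct_inv_le_mul (posDef_smul_one hμ) (h.posDef (posDef_smul_one hμ)) zero_le_one
    (fun v => by simpa using h.dotProduct_le v) g
  rwa [one_mul, dotProduct_inv_smul_one hμ] at this

theorem dotProduct_le_of_upper {A : Mat n} {ω : ℝ} (hω : 0 < ω) (hA : A.PosDef)
    (h : Loewner A (ω • (1 : Mat n))) (g : Fin n → ℝ) :
    g ⬝ᵥ g ≤ ω * (g ⬝ᵥ A⁻¹ *ᵥ g) := by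
  have := dotProduct_inv_le_mul hA (posDef_smul_one hω) zero_le_one
    (fun v => by simpa using h.dotProduct_le v) g
  rw [one_mul, dotProduct_inv_smul_one hω] at this
  calc g ⬝ᵥ g = ω * (ω⁻¹ * (g ⬝ᵥ g)) := by field_simp
    _ ≤ _ := mul_le_mul_of_nonneg_left this hω.le

open scoped MatrixOrder in
/-- The trace of `X B` for positive semidefinite `B` is a sum of values of the form of `X`. -/
theorem exists_trace_mul_eq_sum {B : Mat n} (hB : B.PosSemidef) : ∃ C : Mat n,
    (∀ X : Mat n, (X * B).trace = ∑ j, C j ⬝ᵥ X *ᵥ C j) ∧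
    ∀ v, v ⬝ᵥ B *ᵥ v = ∑ j, (C j ⬝ᵥ v) ^ 2 := by
  obtain ⟨C, rfl⟩ := CStarAlgebra.nonneg_iff_eq_star_mul_self.1 hB.nonneg
  rw [star_eq_conjTranspose, conjTranspose_eq_transpose_of_trivial]
  refine ⟨C, fun X => ?_, fun v => ?_⟩
  · rw [← Matrix.mul_assoc, trace_mul_comm, trace]
    refine Finset.sum_congr rfl fun j _ => ?_
    rw [diag_apply, mul_apply]
    refine Finset.sum_congr rfl fun k _ => ?_
    rw [mul_apply]
    rfl
  · rw [← mulVec_mulVec, dotProduct_mulVec, vecMul_transpose, dotProduct]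
    exact Finset.sum_congr rfl fun j _ => (sq _).symm

theorem trace_mul_le_trace_mul {B X Y : Mat n} (hB : B.PosSemidef) {s : ℝ}
    (h : ∀ v, v ⬝ᵥ X *ᵥ v ≤ s * (v ⬝ᵥ Y *ᵥ v)) :
    (X * B).trace ≤ s * (Y * B).trace := by
  obtain ⟨C, hC, -⟩ := exists_trace_mul_eq_sum hB
  rw [hC, hC, Finset.mul_sum]
  exact Finset.sum_le_sum fun j _ => h _

theorem trace_inv_mul_nonneg {A B : Mat n} (hA : A.PosDef) (hB : B.PosSemidef) :
    0 ≤ (A⁻¹ * B).trace := by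
  obtain ⟨C, hC, -⟩ := exists_trace_mul_eq_sum hB
  rw [hC]
  exact Finset.sum_nonneg fun j _ => dotProduct_mulVec_nonneg hA.inv.posSemidef _

/-- Factor `B = CᵀC` and apply Cauchy–Schwarz to each row of `C`. This turns the trace measure `σ`
into an operator bound `G - A ⪯ σ A`. -/
theorem dotProduct_le_trace_mul {A B : Mat n} (hA : A.PosDef) (hB : B.PosSemidef)
    (v : Fin n → ℝ) : v ⬝ᵥ B *ᵥ v ≤ (A⁻¹ * B).trace * (v ⬝ᵥ A *ᵥ v) := by
  obtain ⟨C, hC, hq⟩ := exists_trace_mul_eq_sum hB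
  rw [hC, hq, Finset.sum_mul]
  exact Finset.sum_le_sum fun j _ => sq_dotProduct_le_inv hA _ _

/-- If `0 ⪯ B ⪯ ε A` then `B A⁻¹ B ⪯ ε B`. -/
theorem mulVec_dotProduct_inv_le {A B : Mat n} (hA : A.PosDef) (hB : B.PosSemidef) {ε : ℝ}
    (hε : 0 ≤ ε) (h : ∀ v, v ⬝ᵥ B *ᵥ v ≤ ε * (v ⬝ᵥ A *ᵥ v)) (v : Fin n → ℝ) :
    (B *ᵥ v) ⬝ᵥ A⁻¹ *ᵥ (B *ᵥ v) ≤ ε * (v ⬝ᵥ B *ᵥ v) := by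
  have h0 := dotProduct_mulVec_nonneg hB v
  refine dotProduct_inv_le hA (mul_nonneg hε h0) fun w => ?_
  rw [mulVec_dotProduct hB.isHermitian]
  calc (v ⬝ᵥ B *ᵥ w) ^ 2 ≤ (v ⬝ᵥ B *ᵥ v) * (w ⬝ᵥ B *ᵥ w) := sq_dotProduct_mulVec_le hB v w
    _ ≤ (v ⬝ᵥ B *ᵥ v) * (ε * (w ⬝ᵥ A *ᵥ w)) := mul_le_mul_of_nonneg_left (h w) h0
    _ = _ := by ring

/-- If `A ⪯ G ⪯ (1 + ε) A` then `(1 + ε) ‖(G - A) v‖_A^* ≤ ε ‖G v‖_A^*`. -/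
theorem sub_mulVec_dotProduct_inv_le {A G : Mat n} (hA : A.PosDef) (hAG : Loewner A G) {ε : ℝ}
    (hε : 0 ≤ ε) (h : ∀ v, v ⬝ᵥ (G - A) *ᵥ v ≤ ε * (v ⬝ᵥ A *ᵥ v)) (v : Fin n → ℝ) :
    (1 + ε) ^ 2 * (((G - A) *ᵥ v) ⬝ᵥ A⁻¹ *ᵥ ((G - A) *ᵥ v)) ≤
      ε ^ 2 * ((G *ᵥ v) ⬝ᵥ A⁻¹ *ᵥ (G *ᵥ v)) := by
  have hB : (G - A).PosSemidef := hAG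
  have h1 := mulVec_dotProduct_inv_le hA hB hε h v
  have h2 := h v
  generalize hBe : G - A = B at *
  obtain rfl : G = A + B := by rw [← hBe]; abel
  have e1 : (A *ᵥ v) ⬝ᵥ A⁻¹ *ᵥ (B *ᵥ v) = v ⬝ᵥ B *ᵥ v := by
    rw [mulVec_dotProduct hA.isHermitian, mulVec_inv_mulVec hA]
  have e2 : (B *ᵥ v) ⬝ᵥ A⁻¹ *ᵥ (A *ᵥ v) = v ⬝ᵥ B *ᵥ v := by
    rw [dotProduct_mulVec_comm hA.inv.isHermitian, e1]
  have e3 : ((A + B) *ᵥ v) ⬝ᵥ A⁻¹ *ᵥ ((A + B) *ᵥ v) =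
      v ⬝ᵥ A *ᵥ v + 2 * (v ⬝ᵥ B *ᵥ v) + (B *ᵥ v) ⬝ᵥ A⁻¹ *ᵥ (B *ᵥ v) := by
    simp only [add_mulVec, mulVec_add, add_dotProduct, dotProduct_add, e1, e2,
      mulVec_dotProduct_inv hA]
    ring
  -- With `a`, `b`, `q` the forms of `A`, `B`, `B A⁻¹ B` at `v`, the claim is `(1 + 2ε) q ≤ ε² (a +
  -- 2b)`, which follows from `q ≤ ε b` and `b ≤ ε a`.
  rw [e3]
  nlinarith [mul_le_mul_of_nonneg_left h1 hε, mul_le_mul_of_nonneg_left h2 hε]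

end Loewner

/-! ### Greedy Broyden updates: preservation of `A ⪯ G` and decrease of `σ`. -/

section Broyden

open Matrix

variable {n : ℕ}

theorem dotProduct_mul_vecMulVec_mul (X Y : Mat n) (u v : Fin n → ℝ) :
    v ⬝ᵥ (X * vecMulVec u u * Y) *ᵥ v = (v ⬝ᵥ X *ᵥ u) * (u ⬝ᵥ Y *ᵥ v) := by
  rw [mul_vecMulVec, vecMulVec_mul, vecMulVec_mulVec, ← dotProduct_mulVec]
  simp [dotProduct_smul, mul_comm]

theorem trace_mul_vecMulVec_mul {Y : Mat n} (hY : Y.IsHermitian) (Z X : Mat n) (u : Fin n → ℝ) :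
    (Z * (X * vecMulVec u u * Y)).trace = (Y *ᵥ u) ⬝ᵥ Z *ᵥ (X *ᵥ u) := by
  have hT : Yᵀ = Y := by simpa [conjTranspose_eq_transpose_of_trivial] using hY.eq
  rw [mul_vecMulVec, vecMulVec_mul, mul_vecMulVec, trace_vecMulVec, dotProduct_comm,
    ← mulVec_transpose, hT]

theorem isHermitian_mul_vecMulVec_mul {X : Mat n} (hX : X.IsHermitian) (u : Fin n → ℝ) :
    (X * vecMulVec u u * X).IsHermitian := by
  have hT : Xᵀ = X := by simpa [conjTranspose_eq_transpose_of_trivial] using hX.eq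
  rw [IsHermitian, conjTranspose_eq_transpose_of_trivial]
  simp [transpose_mul, transpose_vecMulVec, hT, Matrix.mul_assoc]

theorem isHermitian_mul_vecMulVec_add {X Y : Mat n} (hX : X.IsHermitian) (hY : Y.IsHermitian)
    (u : Fin n → ℝ) : (X * vecMulVec u u * Y + Y * vecMulVec u u * X).IsHermitian := by
  have hX' : Xᵀ = X := by simpa [conjTranspose_eq_transpose_of_trivial] using hX.eq
  have hY' : Yᵀ = Y := by simpa [conjTranspose_eq_transpose_of_trivial] using hY.eq
  rw [IsHermitian, conjTranspose_eq_transpose_of_trivial]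
  simp [transpose_mul, transpose_vecMulVec, hX', hY', Matrix.mul_assoc, add_comm]

theorem Broyd_isHermitian {G A : Mat n} (hG : G.IsHermitian) (hA : A.IsHermitian) (φ : ℝ)
    (u : Fin n → ℝ) : (Broyd φ G A u).IsHermitian :=
  (isHermitian_smul
    ((hG.sub (isHermitian_smul (isHermitian_mul_vecMulVec_add hA hG u) _)).add
      (isHermitian_smul (isHermitian_mul_vecMulVec_mul hA u) _)) _).add
    (isHermitian_smul
      (hG.sub (isHermitian_smul (isHermitian_mul_vecMulVec_mul (hG.sub hA) u) _)) _)

/-- By Cauchy–Schwarz for the semidefinite form `G - A`, the subtracted rank-one term never exceeds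
`G - A`. A vanishing denominator is harmless because `0⁻¹ = 0`. -/
theorem le_SR1 {G A : Mat n} (hAG : Loewner A G) (u v : Fin n → ℝ) :
    v ⬝ᵥ A *ᵥ v ≤ v ⬝ᵥ SR1 G A u *ᵥ v := by
  have hB : (G - A).PosSemidef := hAG
  rw [SR1, sub_mulVec, dotProduct_sub, dotProduct_smul_mulVec, dotProduct_mul_vecMulVec_mul,
    dotProduct_mulVec_comm hB.isHermitian u v, quad_eq_dotProduct]
  have h1 := sq_dotProduct_mulVec_le hB v u
  have h2 := dotProduct_mulVec_nonneg hB u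
  have h3 := dotProduct_mulVec_nonneg hB v
  have h4 : v ⬝ᵥ (G - A) *ᵥ v = v ⬝ᵥ G *ᵥ v - v ⬝ᵥ A *ᵥ v := by rw [sub_mulVec, dotProduct_sub]
  have h5 : (u ⬝ᵥ (G - A) *ᵥ u)⁻¹ * ((v ⬝ᵥ (G - A) *ᵥ u) * (v ⬝ᵥ (G - A) *ᵥ u)) ≤
      v ⬝ᵥ (G - A) *ᵥ v := by
    rcases h2.eq_or_lt with h | h
    · rw [← h]
      simpa using h3
    · rw [inv_mul_le_iff₀ h]
      linarith
  linarith

/-- Let `v'` be `v` minus its `A`-orthogonal projection onto `u`. The forms of `DFP` and `A` at `v`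
are those of `G` and `A` at `v'` plus the same term `⟨A u, v⟩² / ⟨A u, u⟩`, so the claim is `A ⪯ G`
at `v'`. -/
theorem le_DFP {G A : Mat n} (hA : A.PosDef) (hAG : Loewner A G) {u : Fin n → ℝ} (hu : u ≠ 0)
    (v : Fin n → ℝ) : v ⬝ᵥ A *ᵥ v ≤ v ⬝ᵥ DFP G A u *ᵥ v := by
  have hG := hAG.isHermitian hA.isHermitian
  have ha : 0 < u ⬝ᵥ A *ᵥ u := (posDef_iff_dotProduct.1 hA).2 u hu
  set a := u ⬝ᵥ A *ᵥ u with hadef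
  have key := hAG.dotProduct_le (v - ((v ⬝ᵥ A *ᵥ u) / a) • u)
  simp only [mulVec_sub, mulVec_smul, dotProduct_sub, sub_dotProduct, dotProduct_smul,
      smul_dotProduct, smul_eq_mul, dotProduct_mulVec_comm hA.isHermitian u v,
      dotProduct_mulVec_comm hG u v, ← hadef] at key
  have e : v ⬝ᵥ DFP G A u *ᵥ v = v ⬝ᵥ G *ᵥ v - a⁻¹ * (2 * (v ⬝ᵥ A *ᵥ u) * (v ⬝ᵥ G *ᵥ u)) +
      ((u ⬝ᵥ G *ᵥ u) / a + 1) * a⁻¹ * (v ⬝ᵥ A *ᵥ u) ^ 2 := by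
    simp only [DFP, add_mulVec, sub_mulVec, dotProduct_add, dotProduct_sub,
      dotProduct_smul_mulVec, dotProduct_mul_vecMulVec_mul, quad_eq_dotProduct,
      dotProduct_mulVec_comm hA.isHermitian u v, dotProduct_mulVec_comm hG u v, ← hadef]
    ring
  rw [e]
  have e2 : v ⬝ᵥ A *ᵥ u / a * a = v ⬝ᵥ A *ᵥ u := div_mul_cancel₀ _ ha.ne'
  have e3 : ((u ⬝ᵥ G *ᵥ u) / a + 1) * a⁻¹ * (v ⬝ᵥ A *ᵥ u) ^ 2 =
      (v ⬝ᵥ A *ᵥ u / a) ^ 2 * (u ⬝ᵥ G *ᵥ u) + (v ⬝ᵥ A *ᵥ u / a) * (v ⬝ᵥ A *ᵥ u) := by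
    field_simp
  have e4 : a⁻¹ * (2 * (v ⬝ᵥ A *ᵥ u) * (v ⬝ᵥ G *ᵥ u)) =
      2 * (v ⬝ᵥ A *ᵥ u / a) * (v ⬝ᵥ G *ᵥ u) := by
    field_simp
  rw [e3, e4]
  rw [e2] at key
  linarith

theorem loewner_Broyd {G A : Mat n} (hA : A.PosDef) (hAG : Loewner A G) {u : Fin n → ℝ}
    (hu : u ≠ 0) {φ : ℝ} (hφ : φ ∈ Set.Icc (0 : ℝ) 1) : Loewner A (Broyd φ G A u) := by
  refine loewner_of_dotProduct_le hA.isHermitian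
    (Broyd_isHermitian (hAG.isHermitian hA.isHermitian) hA.isHermitian _ _) fun v => ?_
  rw [Broyd, add_mulVec, dotProduct_add, dotProduct_smul_mulVec, dotProduct_smul_mulVec]
  have h1 := mul_le_mul_of_nonneg_left (le_DFP hA hAG hu v) hφ.1
  have h2 := mul_le_mul_of_nonneg_left (le_SR1 hAG u v) (sub_nonneg.2 hφ.2)
  linarith

theorem sigma_nonneg {A G : Mat n} (hA : A.PosDef) (hAG : Loewner A G) : 0 ≤ sigma A G :=
  trace_inv_mul_nonneg hA hAG

/-- The trace drops by `(‖(G - A) u‖_A^*)² / ⟨(G - A) u, u⟩`; Cauchy–Schwarz between the `A`-norm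
and its dual bounds this below. -/
theorem sigma_SR1_le {G A : Mat n} (hA : A.PosDef) (hAG : Loewner A G) {u : Fin n → ℝ}
    (hu : u ≠ 0) :
    sigma A (SR1 G A u) ≤ sigma A G - (u ⬝ᵥ (G - A) *ᵥ u) / (u ⬝ᵥ A *ᵥ u) := by
  have hB : (G - A).PosSemidef := hAG
  have ha : 0 < u ⬝ᵥ A *ᵥ u := (posDef_iff_dotProduct.1 hA).2 u hu
  have e : sigma A (SR1 G A u) = sigma A G - (u ⬝ᵥ (G - A) *ᵥ u)⁻¹ *
      (((G - A) *ᵥ u) ⬝ᵥ A⁻¹ *ᵥ ((G - A) *ᵥ u)) := by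
    rw [sigma, SR1, sub_right_comm, Matrix.mul_sub, trace_sub, Matrix.mul_smul, trace_smul,
      trace_mul_vecMulVec_mul hB.isHermitian, quad_eq_dotProduct]
    rfl
  rw [e]
  refine sub_le_sub_left ?_ _
  have h1 := sq_dotProduct_le_inv hA ((G - A) *ᵥ u) u
  rw [mulVec_dotProduct hB.isHermitian] at h1
  rcases (dotProduct_mulVec_nonneg hB u).eq_or_lt with h | h
  · simp [← h]
  · rw [div_le_iff₀ ha, mul_assoc, le_inv_mul_iff₀ h]
    linarith

theorem sigma_DFP {G A : Mat n} (hA : A.PosDef) (hG : G.IsHermitian) {u : Fin n → ℝ}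
    (hu : u ≠ 0) :
    sigma A (DFP G A u) = sigma A G - (u ⬝ᵥ (G - A) *ᵥ u) / (u ⬝ᵥ A *ᵥ u) := by
  have ha : 0 < u ⬝ᵥ A *ᵥ u := (posDef_iff_dotProduct.1 hA).2 u hu
  have e : DFP G A u - A = (G - A) - (quad A u)⁻¹ •
      (A * Matrix.vecMulVec u u * G + G * Matrix.vecMulVec u u * A)
      + ((quad G u / quad A u + 1) * (quad A u)⁻¹) • (A * Matrix.vecMulVec u u * A) := by
    rw [DFP]
    abel
  rw [sigma, e]
  simp only [Matrix.mul_add, Matrix.mul_sub, trace_add, trace_sub, Matrix.mul_smul, trace_smul,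
    trace_mul_vecMulVec_mul hG, trace_mul_vecMulVec_mul hA.isHermitian, inv_mulVec_mulVec hA,
    quad_eq_dotProduct, smul_eq_mul, sigma, sub_mulVec, dotProduct_sub]
  rw [mulVec_dotProduct hG, mulVec_dotProduct hA.isHermitian, mulVec_inv_mulVec hA,
    dotProduct_comm (A *ᵥ u) u]
  field_simp
  ring

/-- `σ` is affine in its second argument, so the convex combination inherits the decrease that DFP
attains exactly and SR1 at least. -/
theorem sigma_Broyd_le {G A : Mat n} (hA : A.PosDef) (hAG : Loewner A G) {u : Fin n → ℝ}
    (hu : u ≠ 0) {φ : ℝ} (hφ : φ ∈ Set.Icc (0 : ℝ) 1) :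
    sigma A (Broyd φ G A u) ≤ sigma A G - (u ⬝ᵥ (G - A) *ᵥ u) / (u ⬝ᵥ A *ᵥ u) := by
  have e : sigma A (Broyd φ G A u) =
      φ * sigma A (DFP G A u) + (1 - φ) * sigma A (SR1 G A u) := by
    have : Broyd φ G A u - A = φ • (DFP G A u - A) + (1 - φ) • (SR1 G A u - A) := by
      rw [Broyd]
      module
    rw [sigma, this, Matrix.mul_add, trace_add, Matrix.mul_smul, Matrix.mul_smul, trace_smul, trace_smul]
    rfl
  rw [e, sigma_DFP hA (hAG.isHermitian hA.isHermitian) hu]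
  have := mul_le_mul_of_nonneg_left (sigma_SR1_le hA hAG hu) (sub_nonneg.2 hφ.2)
  linarith

theorem unitVec_ne_zero (j : Fin n) : unitVec j ≠ 0 := by
  intro h
  have := congrFun h j
  simp [unitVec] at this

/-- `μ I ⪯ A ⪯ ω I`. -/
structure SpectralBounds (μ ω : ℝ) (A : Mat n) : Prop where
  lower : Loewner (μ • (1 : Mat n)) A
  upper : Loewner A (ω • (1 : Mat n))

theorem SpectralBounds.posDef {μ ω : ℝ} {A : Mat n} (h : SpectralBounds μ ω A) (hμ : 0 < μ) :
    A.PosDef :=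
  h.lower.posDef (posDef_smul_one hμ)

theorem SpectralBounds.diag_le {μ ω : ℝ} {A : Mat n} (h : SpectralBounds μ ω A) (i : Fin n) :
    A i i ≤ ω := by
  have := h.upper.dotProduct_le (unitVec i)
  rw [← quad_eq_dotProduct, quad_unitVec, dotProduct_smul_one] at this
  simpa [unitVec] using this

/-- `A⁻¹ ⪯ μ⁻¹ I` reduces `σ` to the plain trace of `G - A`. Subtracting `1` from all ratios does
not change the maximizer, so each diagonal entry is at most `ω` times the greedy relative error. -/
theorem sigma_le_of_isGreedy {μ ω : ℝ} (hμ : 0 < μ) {G A : Mat n} (hA : SpectralBounds μ ω A)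
    (hAG : Loewner A G) {j : Fin n} (hj : IsGreedy G A j) :
    sigma A G ≤ n * (ω / μ) *
      ((unitVec j ⬝ᵥ (G - A) *ᵥ unitVec j) / (unitVec j ⬝ᵥ A *ᵥ unitVec j)) := by
  have hpd := hA.posDef hμ
  have hpos : ∀ i, 0 < A i i := fun i => hpd.diag_pos
  rw [← quad_eq_dotProduct, ← quad_eq_dotProduct, quad_unitVec, quad_unitVec]
  set m := (G - A) j j / A j j with hm
  have hBnn : ∀ i, 0 ≤ (G - A) i i := fun i => Matrix.PosSemidef.diag_nonneg hAG
  have hm0 : 0 ≤ m := div_nonneg (hBnn j) (hpos j).le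
  have hi : ∀ i, (G - A) i i ≤ ω * m := fun i => by
    have h := hj i
    simp only [quad_unitVec] at h
    have h1 : (G - A) i i / A i i ≤ m := by
      rw [hm, Matrix.sub_apply, Matrix.sub_apply, sub_div, sub_div, div_self (hpos i).ne',
        div_self (hpos j).ne']
      linarith
    rw [div_le_iff₀ (hpos i)] at h1
    calc (G - A) i i ≤ m * A i i := h1
      _ ≤ m * ω := mul_le_mul_of_nonneg_left (hA.diag_le i) hm0
      _ = _ := mul_comm _ _
  have h1 : sigma A G ≤ μ⁻¹ * ((1 : Mat n) * (G - A)).trace := by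
    refine trace_mul_le_trace_mul hAG fun v => ?_
    simpa using dotProduct_inv_le_of_lower hμ hA.lower v
  have h2 : ((1 : Mat n) * (G - A)).trace ≤ n * (ω * m) := by
    rw [Matrix.one_mul, trace]
    calc ∑ i, (G - A) i i ≤ ∑ _i : Fin n, ω * m := Finset.sum_le_sum fun i _ => hi i
      _ = _ := by simp
  calc sigma A G ≤ μ⁻¹ * (n * (ω * m)) :=
        h1.trans (mul_le_mul_of_nonneg_left h2 (inv_nonneg.2 hμ.le))
    _ = _ := by ring

theorem loewner_of_isGBroyd {G A G' : Mat n} (hA : A.PosDef) (hAG : Loewner A G)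
    (h : IsGBroyd G A G') : Loewner A G' := by
  obtain ⟨j, -, φ, hφ, rfl⟩ := h
  exact loewner_Broyd hA hAG (unitVec_ne_zero j) hφ

theorem sigma_le_of_isGBroyd {μ ω : ℝ} (hμ : 0 < μ) (hκ : 0 < n * (ω / μ)) {G A G' : Mat n}
    (hA : SpectralBounds μ ω A) (hAG : Loewner A G) (h : IsGBroyd G A G') :
    sigma A G' ≤ rho n (ω / μ) * sigma A G := by
  obtain ⟨j, hj, φ, hφ, rfl⟩ := h
  have h1 := sigma_Broyd_le (hA.posDef hμ) hAG (unitVec_ne_zero j) hφ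
  have h2 := sigma_le_of_isGreedy hμ hA hAG hj
  rw [← div_le_iff₀' hκ] at h2
  have : rho n (ω / μ) * sigma A G = sigma A G - sigma A G / (n * (ω / μ)) := by
    rw [rho]
    ring
  linarith

theorem isGBroydIter_bounds {μ ω : ℝ} (hμ : 0 < μ) (hκ : 0 < n * (ω / μ))
    (hρ : 0 ≤ rho n (ω / μ)) {A : Mat n} (hA : SpectralBounds μ ω A) {t : ℕ} {G H : Mat n}
    (hAG : Loewner A G) (h : IsGBroydIter A t G H) :
    Loewner A H ∧ sigma A H ≤ rho n (ω / μ) ^ t * sigma A G := by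
  induction t generalizing H with
  | zero =>
    obtain rfl : H = G := h
    exact ⟨hAG, by simp⟩
  | succ t ih =>
    obtain ⟨K, hK, hKH⟩ := h
    obtain ⟨h1, h2⟩ := ih hK
    refine ⟨loewner_of_isGBroyd (hA.posDef hμ) h1 hKH, ?_⟩
    calc sigma A H ≤ rho n (ω / μ) * sigma A K := sigma_le_of_isGBroyd hμ hκ hA h1 hKH
      _ ≤ rho n (ω / μ) * (rho n (ω / μ) ^ t * sigma A G) := mul_le_mul_of_nonneg_left h2 hρ
      _ = _ := by ring

theorem sigma_eq_trace_sub {A : Mat n} (hA : A.PosDef) (G : Mat n) :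
    sigma A G = (A⁻¹ * G).trace - n := by
  rw [sigma, Matrix.mul_sub, trace_sub,
    nonsing_inv_mul _ ((isUnit_iff_isUnit_det _).1 hA.isUnit)]
  simp

/-- One factor `s` is the rescaling, the other comes from `A'⁻¹ ⪯ s A⁻¹`; the shift by `n` appears
because `σ + n` is the trace of `A⁻¹ H`. -/
theorem sigma_smul_le {A A' H : Mat n} (hA : A.PosDef) (hA' : A'.PosDef) (hAH : Loewner A H)
    {s : ℝ} (hs : 0 ≤ s) (h : ∀ v, v ⬝ᵥ A *ᵥ v ≤ s * (v ⬝ᵥ A' *ᵥ v)) :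
    sigma A' (s • H) ≤ s ^ 2 * (sigma A H + n) - n := by
  rw [sigma_eq_trace_sub hA, sigma_eq_trace_sub hA', Matrix.mul_smul, trace_smul, smul_eq_mul]
  have := mul_le_mul_of_nonneg_left (trace_mul_le_trace_mul (hAH.posDef hA).posSemidef
    (dotProduct_inv_le_mul hA hA' hs h)) hs
  linarith

/-- One round of a worker: refinement towards `A`, rescaling, and one update towards `A'`. -/
theorem worker_bounds {μ ω : ℝ} (hμ : 0 < μ) (hκ : 0 < n * (ω / μ)) (hρ : 0 ≤ rho n (ω / μ))
    {A A' : Mat n} (hA : SpectralBounds μ ω A) (hA' : SpectralBounds μ ω A') {s : ℝ} (hs : 0 ≤ s)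
    (h : ∀ v, v ⬝ᵥ A *ᵥ v ≤ s * (v ⬝ᵥ A' *ᵥ v)) (h' : ∀ v, v ⬝ᵥ A' *ᵥ v ≤ s * (v ⬝ᵥ A *ᵥ v))
    {τ : ℕ} {G H G' : Mat n} (hAG : Loewner A G) (hH : IsGBroydIter A τ G H)
    (hG' : IsGBroyd (s • H) A' G') :
    Loewner A' G' ∧
      sigma A' G' ≤ rho n (ω / μ) * (s ^ 2 * (rho n (ω / μ) ^ τ * sigma A G + n) - n) := by
  obtain ⟨h1, h2⟩ := isGBroydIter_bounds hμ hκ hρ hA hAG hH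
  have hpd := hA.posDef hμ
  have hpd' := hA'.posDef hμ
  -- The rescaling restores domination at the new point: `A' ⪯ s A ⪯ s H`.
  have h3 : Loewner A' (s • H) := by
    refine loewner_of_dotProduct_le hpd'.isHermitian
      (isHermitian_smul (h1.isHermitian hpd.isHermitian) s) fun v => (h' v).trans ?_
    rw [dotProduct_smul_mulVec]
    exact mul_le_mul_of_nonneg_left (h1.dotProduct_le v) hs
  refine ⟨loewner_of_isGBroyd hpd' h3 hG', ?_⟩
  refine (sigma_le_of_isGBroyd hμ hκ hA' h3 hG').trans (mul_le_mul_of_nonneg_left ?_ hρ)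
  refine (sigma_smul_le hpd hpd' h1 hs h).trans ?_
  have := mul_le_mul_of_nonneg_left h2 (sq_nonneg s)
  linarith

end Broyden

/-! ### Weighted norms and Taylor remainders of the gradient. -/

section Analysis

open Matrix

variable {n : ℕ}

theorem inner_eq_dotProduct (x y : E n) : inner ℝ x y = x.ofLp ⬝ᵥ y.ofLp := by
  rw [EuclideanSpace.inner_eq_star_dotProduct, star_trivial, dotProduct_comm]

theorem norm_sq_eq_dotProduct (x : E n) : ‖x‖ ^ 2 = x.ofLp ⬝ᵥ x.ofLp := by
  rw [← inner_eq_dotProduct, real_inner_self_eq_norm_sq]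

theorem inner_act (A : Mat n) (h w : E n) :
    inner ℝ (act A h) w = w.ofLp ⬝ᵥ A *ᵥ h.ofLp := by
  rw [real_inner_comm, inner_eq_dotProduct]
  rfl

theorem ofLp_act (A : Mat n) (h : E n) : (act A h).ofLp = A *ᵥ h.ofLp := rfl

theorem wnorm_eq_sqrt (A : Mat n) (h : E n) : wnorm A h = √(h.ofLp ⬝ᵥ A *ᵥ h.ofLp) := by
  rw [wnorm, inner_act]

theorem wnorm_sq {A : Mat n} (hA : A.PosSemidef) (h : E n) :
    wnorm A h ^ 2 = h.ofLp ⬝ᵥ A *ᵥ h.ofLp := by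
  rw [wnorm_eq_sqrt, Real.sq_sqrt (dotProduct_mulVec_nonneg hA _)]

theorem wnorm_nonneg (A : Mat n) (h : E n) : 0 ≤ wnorm A h := Real.sqrt_nonneg _

theorem dualNorm_nonneg (A : Mat n) (h : E n) : 0 ≤ dualNorm A h := Real.sqrt_nonneg _

theorem dualNorm_sq {A : Mat n} (hA : A.PosDef) (h : E n) :
    dualNorm A h ^ 2 = h.ofLp ⬝ᵥ A⁻¹ *ᵥ h.ofLp :=
  wnorm_sq hA.inv.posSemidef h

theorem wnorm_smul (A : Mat n) (c : ℝ) (h : E n) : wnorm A (c • h) = |c| * wnorm A h := by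
  rw [wnorm_eq_sqrt, wnorm_eq_sqrt, ← Real.sqrt_sq_eq_abs, ← Real.sqrt_mul (sq_nonneg c)]
  congr 1
  simp only [WithLp.ofLp_smul, mulVec_smul, dotProduct_smul, smul_dotProduct, smul_eq_mul]
  ring

theorem wnorm_neg (A : Mat n) (h : E n) : wnorm A (-h) = wnorm A h := by
  simpa using wnorm_smul A (-1) h

theorem wnorm_add_le {A : Mat n} (hA : A.PosSemidef) (h k : E n) :
    wnorm A (h + k) ≤ wnorm A h + wnorm A k := by
  refine le_of_sq_le_sq ?_ (add_nonneg (wnorm_nonneg _ _) (wnorm_nonneg _ _))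
  have e : wnorm A (h + k) ^ 2 =
      wnorm A h ^ 2 + 2 * (h.ofLp ⬝ᵥ A *ᵥ k.ofLp) + wnorm A k ^ 2 := by
    rw [wnorm_sq hA, wnorm_sq hA, wnorm_sq hA]
    simp only [WithLp.ofLp_add, mulVec_add, dotProduct_add, add_dotProduct,
      dotProduct_mulVec_comm hA.isHermitian k.ofLp h.ofLp]
    ring
  have h1 : h.ofLp ⬝ᵥ A *ᵥ k.ofLp ≤ wnorm A h * wnorm A k := by
    refine le_of_abs_le (abs_le_of_sq_le_sq ?_ (mul_nonneg (wnorm_nonneg _ _) (wnorm_nonneg _ _)))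
    rw [mul_pow, wnorm_sq hA, wnorm_sq hA]
    exact sq_dotProduct_mulVec_le hA _ _
  rw [e]
  nlinarith

/-- A symmetric form bounded by `c A` on the diagonal is bounded by `c A` as a bilinear form. -/
theorem sq_dotProduct_mulVec_le_of_abs_le {A B : Mat n} (hA : A.IsHermitian) (hB : B.IsHermitian)
    {c : ℝ} (h : ∀ v, |v ⬝ᵥ B *ᵥ v| ≤ c * (v ⬝ᵥ A *ᵥ v)) (w d : Fin n → ℝ) :
    (w ⬝ᵥ B *ᵥ d) ^ 2 ≤ c ^ 2 * ((w ⬝ᵥ A *ᵥ w) * (d ⬝ᵥ A *ᵥ d)) := by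
  have key : ∀ t : ℝ, 0 ≤ (c * (d ⬝ᵥ A *ᵥ d)) * (t * t) + (2 * (w ⬝ᵥ B *ᵥ d)) * t +
      c * (w ⬝ᵥ A *ᵥ w) := by
    intro t
    have h1 := (abs_le.1 (h (w + t • d))).1
    have h2 := (abs_le.1 (h (w - t • d))).2
    simp only [mulVec_add, mulVec_sub, mulVec_smul, dotProduct_add, add_dotProduct,
      dotProduct_sub, sub_dotProduct, dotProduct_smul, smul_dotProduct, smul_eq_mul,
      dotProduct_mulVec_comm hA d w, dotProduct_mulVec_comm hB d w] at h1 h2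
    linarith
  have := discrim_le_zero key
  rw [discrim] at this
  linarith

/-- `A` is the Jacobian of the map `g`, `m I ⪯ A(x) ⪯ W I`, and `A` is Lipschitz and strongly
self-concordant. -/
structure IsHessianField (m W ℓ M : ℝ) (g : E n → E n) (A : E n → Mat n) : Prop where
  hasFDerivAt : ∀ x, HasFDerivAt g (Matrix.toEuclideanCLM (n := Fin n) (𝕜 := ℝ) (A x)) x
  bounds : ∀ x, SpectralBounds m W (A x)
  lipschitz : ∀ x y, ‖Matrix.toEuclideanCLM (n := Fin n) (𝕜 := ℝ) (A y - A x)‖ ≤ ℓ * ‖y - x‖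
  concordant : ∀ x y z w v, v ⬝ᵥ (A y - A x) *ᵥ v ≤
    M * wnorm (A z) (y - x) * (v ⬝ᵥ A w *ᵥ v)

namespace IsHessianField

variable {m W ℓ M : ℝ} {g : E n → E n} {A : E n → Mat n}

/-- Testing against a fixed `w` makes the remainder scalar: `K t²/2` minus the tested increment has
nonnegative derivative for `t ≥ 0`. Monotonicity replaces the integral form, so no continuity of the
Hessian is needed. -/
theorem inner_remainder_le (hg : IsHessianField m W ℓ M g A) (x d w : E n) {K : ℝ}
    (hK : ∀ t : ℝ, 0 ≤ t → w.ofLp ⬝ᵥ (A (x + t • d) - A x) *ᵥ d.ofLp ≤ K * t) :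
    inner ℝ (g (x + d) - g x - act (A x) d) w ≤ K / 2 := by
  set h : ℝ → ℝ := fun t =>
    K * t ^ 2 / 2 - (inner ℝ (g (x + t • d)) w - t * inner ℝ (act (A x) d) w) with hh
  have hd : ∀ t, HasDerivAt h
      (K * t - (inner ℝ (act (A (x + t • d)) d) w - inner ℝ (act (A x) d) w)) t := by
    intro t
    have h1 : HasDerivAt (fun t : ℝ => x + t • d) d t := by
      simpa using ((hasDerivAt_id t).smul_const d).const_add x
    have h2 : HasDerivAt (fun t : ℝ => g (x + t • d)) (act (A (x + t • d)) d) t :=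
      (hg.hasFDerivAt (x + t • d)).comp_hasDerivAt t h1
    have h3 : HasDerivAt (fun t : ℝ => inner ℝ (g (x + t • d)) w)
        (inner ℝ (act (A (x + t • d)) d) w) t := by
      simpa using h2.inner ℝ (hasDerivAt_const t w)
    have h4 : HasDerivAt (fun t : ℝ => K * t ^ 2 / 2) (K * t) t := by
      exact (((hasDerivAt_pow 2 t).const_mul K).div_const 2).congr_deriv (by push_cast; ring)
    have h5 : HasDerivAt (fun t : ℝ => t * inner ℝ (act (A x) d) w)
        (inner ℝ (act (A x) d) w) t := by
      simpa using (hasDerivAt_id t).mul_const (inner ℝ (act (A x) d) w)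
    exact h4.sub (h3.sub h5)
  have hmono : MonotoneOn h (Set.Ici 0) := by
    refine monotoneOn_of_deriv_nonneg (convex_Ici 0)
      (fun t _ => (hd t).continuousAt.continuousWithinAt)
      (fun t _ => (hd t).differentiableAt.differentiableWithinAt) fun t ht => ?_
    rw [interior_Ici, Set.mem_Ioi] at ht
    rw [(hd t).deriv, inner_act, inner_act]
    have := hK t ht.le
    rw [sub_mulVec, dotProduct_sub] at this
    linarith
  have h01 := hmono (Set.mem_Ici.2 le_rfl) (Set.mem_Ici.2 zero_le_one) zero_le_one
  simp only [hh, zero_smul, one_smul, add_zero] at h01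
  rw [inner_sub_left, inner_sub_left]
  linarith

/-- The remainder `e` is tested against itself and one factor `‖e‖` is cancelled. -/
theorem norm_remainder_le (hg : IsHessianField m W ℓ M g A) (x d : E n) :
    ‖g (x + d) - g x - act (A x) d‖ ≤ ℓ / 2 * ‖d‖ ^ 2 := by
  set e := g (x + d) - g x - act (A x) d with he
  have h := hg.inner_remainder_le x d e (K := ℓ * ‖d‖ ^ 2 * ‖e‖) fun t ht => by
    rw [← inner_act]
    calc inner ℝ (act (A (x + t • d) - A x) d) e ≤ ‖act (A (x + t • d) - A x) d‖ * ‖e‖ :=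
          real_inner_le_norm _ _
      _ ≤ (ℓ * ‖(x + t • d) - x‖ * ‖d‖) * ‖e‖ := by
          refine mul_le_mul_of_nonneg_right ?_ (norm_nonneg _)
          exact ((Matrix.toEuclideanCLM (n := Fin n) (𝕜 := ℝ) _).le_opNorm d).trans
            (mul_le_mul_of_nonneg_right (hg.lipschitz _ _) (norm_nonneg _))
      _ = ℓ * ‖d‖ ^ 2 * ‖e‖ * t := by
          rw [add_sub_cancel_left, norm_smul, Real.norm_of_nonneg ht]
          ring
  rw [← he, real_inner_self_eq_norm_sq] at h
  rcases (norm_nonneg e).eq_or_lt with h0 | h0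
  -- The sign of `ℓ` is not assumed; the Lipschitz bound itself supplies it.
  · have hℓ : 0 ≤ ℓ * ‖d‖ := by
      simpa using (norm_nonneg _).trans (hg.lipschitz x (x + d))
    rw [← h0]
    nlinarith [norm_nonneg d]
  · nlinarith

theorem posDef (hg : IsHessianField m W ℓ M g A) (hm : 0 < m) (x : E n) : (A x).PosDef :=
  (hg.bounds x).posDef hm

/-- Self-concordance in both directions bounds the Hessian difference on the diagonal by a multiple
of `A x`; polarization extends this to the pairing with any `w`, which controls the dual norm. -/
theorem dualNorm_remainder_le (hg : IsHessianField m W ℓ M g A) (hm : 0 < m) (hM : 0 ≤ M)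
    (x d : E n) :
    dualNorm (A x) (g (x + d) - g x - act (A x) d) ≤ M / 2 * wnorm (A x) d ^ 2 := by
  set e := g (x + d) - g x - act (A x) d with he
  have hpd := hg.posDef hm
  have hr := wnorm_nonneg (A x) d
  have key : ∀ w : E n, inner ℝ e w ≤ M / 2 * wnorm (A x) d ^ 2 * wnorm (A x) w := by
    intro w
    have h := hg.inner_remainder_le x d w (K := M * wnorm (A x) d ^ 2 * wnorm (A x) w)
      fun t ht => by
        have hB : ∀ v, |v ⬝ᵥ (A (x + t • d) - A x) *ᵥ v| ≤
            (M * (t * wnorm (A x) d)) * (v ⬝ᵥ A x *ᵥ v) := by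
          intro v
          have h1 := hg.concordant x (x + t • d) x x v
          have h2 := hg.concordant (x + t • d) x x x v
          rw [add_sub_cancel_left, wnorm_smul, abs_of_nonneg ht] at h1
          rw [sub_add_cancel_left, wnorm_neg, wnorm_smul, abs_of_nonneg ht, ← neg_sub,
            neg_mulVec, dotProduct_neg] at h2
          exact abs_le.2 ⟨by linarith, h1⟩
        have h3 := sq_dotProduct_mulVec_le_of_abs_le (hpd x).isHermitian
          ((hpd (x + t • d)).isHermitian.sub (hpd x).isHermitian) hB w.ofLp d.ofLp
        rw [← wnorm_sq (hpd x).posSemidef, ← wnorm_sq (hpd x).posSemidef, ← mul_pow, ← mul_pow]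
          at h3
        have hw := wnorm_nonneg (A x) w
        refine (le_of_abs_le (abs_le_of_sq_le_sq h3 (by positivity))).trans (le_of_eq ?_)
        ring
    rw [← he] at h
    linarith
  have hC : 0 ≤ M / 2 * wnorm (A x) d ^ 2 := by positivity
  refine le_of_sq_le_sq ?_ hC
  rw [dualNorm_sq (hpd x)]
  refine dotProduct_inv_le (hpd x) (sq_nonneg _) fun v => ?_
  have h1 := key (WithLp.toLp 2 v)
  have h2 := key (-WithLp.toLp 2 v)
  rw [inner_neg_right, wnorm_neg] at h2
  have h3 : v ⬝ᵥ A x *ᵥ v = wnorm (A x) (WithLp.toLp 2 v) ^ 2 :=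
    (wnorm_sq (hpd x).posSemidef (WithLp.toLp 2 v)).symm
  have h4 : e.ofLp ⬝ᵥ v = inner ℝ e (WithLp.toLp 2 v) := (inner_eq_dotProduct _ _).symm
  rw [h3, h4, ← mul_pow]
  exact sq_le_sq' (by linarith) h1

end IsHessianField

end Analysis

/-! ### The effect of one quasi-Newton step on the gradient. -/

section Steps

open Matrix

variable {n : ℕ} {A G : Mat n}

theorem act_smul (A : Mat n) (c : ℝ) (h : E n) : act A (c • h) = c • act A h :=
  map_smul _ _ _

theorem act_neg (A : Mat n) (h : E n) : act A (-h) = -act A h :=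
  map_neg _ _

theorem act_zero (A : Mat n) : act A (0 : E n) = 0 :=
  map_zero _

theorem act_sub_left (A B : Mat n) (h : E n) : act (A - B) h = act A h - act B h := by
  simp [act]

theorem act_act_inv (hG : G.PosDef) (g : E n) : act G (act G⁻¹ g) = g := by
  apply (WithLp.ofLp_injective 2)
  rw [ofLp_act, ofLp_act, mulVec_inv_mulVec hG]

theorem wnorm_act_inv (hG : G.PosDef) (g : E n) : wnorm G (act G⁻¹ g) = dualNorm G g := by
  rw [dualNorm, wnorm_eq_sqrt, wnorm_eq_sqrt, ofLp_act, mulVec_inv_mulVec hG, dotProduct_comm]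

theorem wnorm_mono (hAG : Loewner A G) (h : E n) : wnorm A h ≤ wnorm G h := by
  rw [wnorm_eq_sqrt, wnorm_eq_sqrt]
  exact Real.sqrt_le_sqrt (hAG.dotProduct_le _)

theorem wnorm_act_inv_le (hA : A.PosDef) (hAG : Loewner A G) (g : E n) :
    wnorm A (act G⁻¹ g) ≤ dualNorm G g :=
  (wnorm_mono hAG _).trans (wnorm_act_inv (hAG.posDef hA) g).le

theorem dualNorm_anti (hA : A.PosDef) (hAG : Loewner A G) (g : E n) :
    dualNorm G g ≤ dualNorm A g := by
  rw [dualNorm, dualNorm, wnorm_eq_sqrt, wnorm_eq_sqrt]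
  refine Real.sqrt_le_sqrt ?_
  simpa using dotProduct_inv_le_mul hA (hAG.posDef hA) zero_le_one
    (fun v => by simpa using hAG.dotProduct_le v) g.ofLp

theorem Loewner.trans {A B C : Mat n} (h : Loewner A B) (h' : Loewner B C) : Loewner A C := by
  have := Matrix.PosSemidef.add h' h
  rwa [sub_add_sub_cancel] at this

theorem norm_act_inv_le {m : ℝ} (hm : 0 < m) (hG : Loewner (m • (1 : Mat n)) G) (g : E n) :
    m * ‖act G⁻¹ g‖ ≤ ‖g‖ := by
  have hpd := hG.posDef (posDef_smul_one hm)
  have h1 := hG.dotProduct_le (act G⁻¹ g).ofLp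
  rw [dotProduct_smul_one, ← norm_sq_eq_dotProduct, ← ofLp_act G, act_act_inv hpd,
    ← inner_eq_dotProduct] at h1
  have h2 := real_inner_le_norm (act G⁻¹ g) g
  rcases (norm_nonneg (act G⁻¹ g)).eq_or_lt with h | h
  · rw [← h]
    simp
  · nlinarith

theorem sqrt_mul_dualNorm_le {m : ℝ} (hm : 0 < m) (hG : Loewner (m • (1 : Mat n)) G) (g : E n) :
    √m * dualNorm G g ≤ ‖g‖ := by
  refine le_of_sq_le_sq ?_ (norm_nonneg _)
  rw [mul_pow, Real.sq_sqrt hm.le, dualNorm_sq (hG.posDef (posDef_smul_one hm)),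
    norm_sq_eq_dotProduct]
  have := mul_le_mul_of_nonneg_left (dotProduct_inv_le_of_lower hm hG g.ofLp) hm.le
  rwa [mul_inv_cancel_left₀ hm.ne'] at this

theorem dualNorm_sub_act_le (hA : A.PosDef) (hAG : Loewner A G) {η : ℝ} (hη : 0 ≤ η)
    (h : ∀ v, v ⬝ᵥ (G - A) *ᵥ v ≤ η * (v ⬝ᵥ A *ᵥ v)) (g : E n) :
    (1 + η) * dualNorm A (act (G - A) (act G⁻¹ g)) ≤ η * dualNorm A g := by
  refine le_of_sq_le_sq ?_ (mul_nonneg hη (dualNorm_nonneg _ _))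
  rw [mul_pow, mul_pow, dualNorm_sq hA, dualNorm_sq hA]
  have := sub_mulVec_dotProduct_inv_le hA hAG hη h (act G⁻¹ g).ofLp
  rwa [← ofLp_act G, act_act_inv (hAG.posDef hA)] at this

/-- `ε₀` is the value with `ε₀ / (1 + ε₀) = 1 / (2κ)`. Passing between the dual and the Euclidean
norm costs `√κ`, which leaves `1 / (2√κ) ≤ 1/2`. -/
theorem norm_sub_act_le {m κ : ℝ} (hm : 0 < m) (hκ : 1 ≤ κ)
    (hA : SpectralBounds m (κ * m) A) (hAG : Loewner A G)
    (h : ∀ v, v ⬝ᵥ (G - A) *ᵥ v ≤ eps0 κ * (v ⬝ᵥ A *ᵥ v)) (g : E n) :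
    ‖act (G - A) (act G⁻¹ g)‖ ≤ 1 / 2 * ‖g‖ := by
  have hpd := hA.posDef hm
  have hκ' : 0 < 2 * κ - 1 := by linarith
  have hη : 0 ≤ eps0 κ := by rw [eps0]; positivity
  have h1 := dualNorm_sub_act_le hpd hAG hη h g
  have h2 : 1 + eps0 κ = 2 * κ * eps0 κ := by
    rw [eps0]
    field_simp
    ring
  have hη0 : 0 < eps0 κ := by rw [eps0]; positivity
  rw [h2, mul_right_comm, mul_comm, mul_le_mul_iff_right₀ hη0] at h1
  have h3 := dotProduct_le_of_upper (by positivity) hpd hA.upper (act (G - A) (act G⁻¹ g)).ofLp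
  have h4 := dotProduct_inv_le_of_lower hm hA.lower g.ofLp
  rw [← norm_sq_eq_dotProduct, ← dualNorm_sq hpd] at h3 h4
  set q := dualNorm A (act (G - A) (act G⁻¹ g))
  set l := dualNorm A g
  set N := ‖act (G - A) (act G⁻¹ g)‖
  have h5 : (2 * κ * q) ^ 2 ≤ l ^ 2 :=
    pow_le_pow_left₀ (mul_nonneg (by linarith) (dualNorm_nonneg _ _)) h1 2
  have h6 : m * l ^ 2 ≤ ‖g‖ ^ 2 := by
    have := mul_le_mul_of_nonneg_left h4 hm.le
    rwa [mul_inv_cancel_left₀ hm.ne'] at this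
  refine le_of_sq_le_sq ?_ (by positivity)
  have h7 : 4 * κ * N ^ 2 ≤ ‖g‖ ^ 2 := by
    calc 4 * κ * N ^ 2 ≤ 4 * κ * (κ * m * q ^ 2) :=
          mul_le_mul_of_nonneg_left h3 (by positivity)
      _ = m * (2 * κ * q) ^ 2 := by ring
      _ ≤ m * l ^ 2 := mul_le_mul_of_nonneg_left h5 hm.le
      _ ≤ _ := h6
  have h8 : N ^ 2 ≤ κ * N ^ 2 := le_mul_of_one_le_left (sq_nonneg _) hκ
  linarith

namespace IsHessianField

variable {m κ W ℓ M : ℝ} {g : E n → E n} {H : E n → Mat n}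

theorem norm_step_le (hg : IsHessianField m (κ * m) ℓ M g H) (hm : 0 < m) (hκ : 1 ≤ κ)
    (hℓ : 0 ≤ ℓ) (x : E n) (hAG : Loewner (H x) G)
    (h : ∀ v, v ⬝ᵥ (G - H x) *ᵥ v ≤ eps0 κ * (v ⬝ᵥ H x *ᵥ v)) {α : ℝ} (h0 : 0 ≤ α)
    (h1 : α ≤ 1) :
    ‖g (x - α • act G⁻¹ (g x))‖ ≤
      (1 - α / 2) * ‖g x‖ + ℓ / 2 * (α ^ 2 * (‖g x‖ / m) ^ 2) := by
  have hG := hAG.posDef (hg.posDef hm x)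
  have hd : ‖act G⁻¹ (g x)‖ ≤ ‖g x‖ / m := by
    rw [le_div_iff₀' hm]
    exact norm_act_inv_le hm ((hg.bounds x).lower.trans hAG) _
  have hrem := hg.norm_remainder_le x (-(α • act G⁻¹ (g x)))
  have hB := norm_sub_act_le hm hκ (hg.bounds x) hAG h (g x)
  rw [norm_neg, norm_smul, Real.norm_of_nonneg h0, mul_pow] at hrem
  have e : g (x - α • act G⁻¹ (g x)) =
      (1 - α) • g x + α • act (G - H x) (act G⁻¹ (g x)) +
        (g (x + -(α • act G⁻¹ (g x))) - g x - act (H x) (-(α • act G⁻¹ (g x)))) := by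
    rw [act_sub_left, act_act_inv hG, act_neg, act_smul, ← sub_eq_add_neg]
    module
  rw [e]
  refine (norm_add_le _ _).trans (add_le_add ((norm_add_le _ _).trans ?_) (hrem.trans ?_))
  · rw [norm_smul, norm_smul, Real.norm_of_nonneg h0, Real.norm_of_nonneg (sub_nonneg.2 h1)]
    have := mul_le_mul_of_nonneg_left hB h0
    linarith
  · gcongr

/-- The second factor is the contraction measured in the old metric `H x`: linear error plus Taylor
remainder. The first is the price of passing to the metric at the new point. -/
theorem dualNorm_step_le (hg : IsHessianField m W ℓ M g H) (hm : 0 < m) (hM : 0 ≤ M)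
    (x : E n) (hAG : Loewner (H x) G) {η : ℝ} (hη : 0 ≤ η)
    (h : ∀ v, v ⬝ᵥ (G - H x) *ᵥ v ≤ η * (v ⬝ᵥ H x *ᵥ v)) :
    dualNorm (H (x - act G⁻¹ (g x))) (g (x - act G⁻¹ (g x))) ≤
      (1 + M * dualNorm (H x) (g x) / 2) *
        (η / (1 + η) + M * dualNorm (H x) (g x) / 2) * dualNorm (H x) (g x) := by
  have hA := hg.posDef hm x
  have hG := hAG.posDef hA
  set l := dualNorm (H x) (g x) with hl
  have hl0 : 0 ≤ l := dualNorm_nonneg _ _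
  set d := -act G⁻¹ (g x) with hd
  have hxd : x - act G⁻¹ (g x) = x + d := sub_eq_add_neg _ _
  rw [hxd]
  have hr : wnorm (H x) d ≤ l := by
    rw [hd, wnorm_neg]
    exact (wnorm_act_inv_le hA hAG _).trans (dualNorm_anti hA hAG _)
  have hr0 : 0 ≤ wnorm (H x) d := wnorm_nonneg _ _
  have hrem := hg.dualNorm_remainder_le hm hM x d
  have hB := dualNorm_sub_act_le hA hAG hη h (g x)
  have e : g (x + d) = act (G - H x) (act G⁻¹ (g x)) + (g (x + d) - g x - act (H x) d) := by
    rw [act_sub_left, act_act_inv hG, hd, act_neg]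
    abel
  have h1 : dualNorm (H x) (g (x + d)) ≤ (η / (1 + η) + M * l / 2) * l := by
    rw [e, add_mul]
    refine (wnorm_add_le hA.inv.posSemidef _ _).trans (add_le_add ?_ (hrem.trans ?_))
    · rw [div_mul_eq_mul_div, le_div_iff₀ (by linarith)]
      rwa [mul_comm]
    · calc M / 2 * wnorm (H x) d ^ 2 ≤ M / 2 * l ^ 2 := by gcongr
        _ = _ := by ring
  have h2 : dualNorm (H (x + d)) (g (x + d)) ≤ (1 + M * l / 2) * dualNorm (H x) (g (x + d)) := by
    have hs : 0 ≤ M * l := mul_nonneg hM hl0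
    refine le_of_sq_le_sq ?_ (mul_nonneg (by linarith) (dualNorm_nonneg _ _))
    rw [mul_pow, dualNorm_sq (hg.posDef hm _), dualNorm_sq hA]
    have h3 := dotProduct_inv_le_mul hA (hg.posDef hm (x + d)) (s := 1 + M * l) (by linarith)
      (fun v => by
        have h4 := hg.concordant (x + d) x x (x + d) v
        rw [sub_add_cancel_left, wnorm_neg, sub_mulVec, dotProduct_sub] at h4
        have h5 := dotProduct_mulVec_nonneg (hg.posDef hm (x + d)).posSemidef v
        have h6 := mul_le_mul_of_nonneg_right (mul_le_mul_of_nonneg_left hr hM) h5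
        linarith) (g (x + d)).ofLp
    refine h3.trans (mul_le_mul_of_nonneg_right ?_
      (dotProduct_mulVec_nonneg hA.inv.posSemidef _))
    -- `1 + s ≤ (1 + s/2)²` with `s = M l`.
    nlinarith [sq_nonneg (M * l)]
  calc _ ≤ _ := h2
    _ ≤ (1 + M * l / 2) * ((η / (1 + η) + M * l / 2) * l) :=
        mul_le_mul_of_nonneg_left h1 (by positivity)
    _ = _ := by ring

end IsHessianField

end Steps

/-! ### From the local functions to their sum. -/

section Sums

open Matrix

variable {n p : ℕ}

theorem gradient_total {f : Fin p → E n → ℝ} (hf : ∀ i, Differentiable ℝ (f i)) :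
    gradient (total f) = fun x => ∑ i, gradient (f i) x := by
  funext x
  have : total f = fun x => ∑ i, f i x := rfl
  rw [gradient, this, fderiv_fun_sum fun i _ => (hf i) x, map_sum]
  rfl

theorem toEuclideanCLM_hess (f : E n → ℝ) (x : E n) :
    Matrix.toEuclideanCLM (n := Fin n) (𝕜 := ℝ) (hess f x) = fderiv ℝ (gradient f) x :=
  (Matrix.toEuclideanCLM (n := Fin n) (𝕜 := ℝ)).apply_symm_apply _

theorem hess_total {f : Fin p → E n → ℝ} (hf : ∀ i, Differentiable ℝ (f i))
    (hf' : ∀ i, Differentiable ℝ (gradient (f i))) (x : E n) :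
    hess (total f) x = ∑ i, hess (f i) x := by
  rw [hess, gradient_total hf, fderiv_fun_sum fun i _ => (hf' i) x, map_sum]
  rfl

theorem dotProduct_sum_mulVec (A : Fin p → Mat n) (v w : Fin n → ℝ) :
    v ⬝ᵥ (∑ i, A i) *ᵥ w = ∑ i, v ⬝ᵥ A i *ᵥ w := by
  rw [sum_mulVec, dotProduct_sum]

theorem Loewner.sum {A B : Fin p → Mat n} (h : ∀ i, Loewner (A i) (B i)) :
    Loewner (∑ i, A i) (∑ i, B i) := by
  rw [Loewner, ← Finset.sum_sub_distrib]
  exact posSemidef_sum _ fun i _ => h i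

theorem Regular.isHessianField {μ ω L M : ℝ} {f : E n → ℝ} (hf : Regular μ ω L f)
    (hsc : StronglySelfConcordant M f) : IsHessianField μ ω L M (gradient f) (hess f) where
  hasFDerivAt x := by
    rw [toEuclideanCLM_hess]
    exact (hf.differentiable_gradient x).hasFDerivAt
  bounds x := ⟨hf.lower x, hf.upper x⟩
  lipschitz := hf.lipschitz
  concordant x y z w v := by
    have := (hsc x y z w).dotProduct_le v
    rwa [dotProduct_smul_mulVec] at this

theorem sum_smul_one (c : ℝ) : ∑ _i : Fin p, c • (1 : Mat n) = (p * c) • (1 : Mat n) := by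
  rw [Finset.sum_const, Finset.card_univ, Fintype.card_fin, mul_smul, Nat.cast_smul_eq_nsmul]

/-- The spectral and Lipschitz constants are multiplied by `p`, but `M` is unchanged: each local
weighted norm is at most the total one. -/
theorem isHessianField_total {μ ω L M : ℝ} (hμ : 0 < μ) (hM : 0 ≤ M) {f : Fin p → E n → ℝ}
    (hf : ∀ i, Regular μ ω L (f i)) (hsc : ∀ i, StronglySelfConcordant M (f i)) :
    IsHessianField (p * μ) (p * ω) (p * L) M (gradient (total f)) (hess (total f)) := by
  have hi := fun i => (hf i).isHessianField (hsc i)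
  have hH := hess_total (fun i => (hf i).differentiable)
    (fun i => (hf i).differentiable_gradient)
  refine ⟨fun x => ?_, fun x => ⟨?_, ?_⟩, fun x y => ?_, fun x y z w v => ?_⟩
  · rw [hH, gradient_total fun i => (hf i).differentiable, map_sum]
    exact HasFDerivAt.fun_sum fun i _ => (hi i).hasFDerivAt x
  · rw [hH, ← sum_smul_one]
    exact Loewner.sum fun i => (hf i).lower x
  · rw [hH, ← sum_smul_one]
    exact Loewner.sum fun i => (hf i).upper x
  · rw [hH, hH, ← Finset.sum_sub_distrib, map_sum]
    refine (norm_sum_le _ _).trans ((Finset.sum_le_sum fun i _ => (hf i).lipschitz x y).trans ?_)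
    simp [mul_assoc]
  · have hp0 : ∀ i x v, 0 ≤ v ⬝ᵥ hess (f i) x *ᵥ v := fun i x v =>
      dotProduct_mulVec_nonneg ((hi i).posDef hμ x).posSemidef v
    rw [hH, hH, hH w, ← Finset.sum_sub_distrib, dotProduct_sum_mulVec, dotProduct_sum_mulVec,
      Finset.mul_sum]
    refine Finset.sum_le_sum fun i _ => ((hi i).concordant x y z w v).trans ?_
    refine mul_le_mul_of_nonneg_right (mul_le_mul_of_nonneg_left ?_ hM) (hp0 i w v)
    rw [wnorm_eq_sqrt, wnorm_eq_sqrt, hH, dotProduct_sum_mulVec]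
    exact Real.sqrt_le_sqrt (Finset.single_le_sum (fun j _ => hp0 j z _) (Finset.mem_univ i))

end Sums

/-! ### Scalar inequalities: the constant `c_{τ,ε}`, the stepsize regimes and the potential. -/

section Scalars

theorem rho_mem_Ioo {n : ℕ} {κ : ℝ} (h : 1 < n * κ) : rho n κ ∈ Set.Ioo (0 : ℝ) 1 := by
  have h0 : 0 < n * κ := by linarith
  have h1 : 1 / (n * κ) < 1 := by rwa [div_lt_one h0]
  have h2 : 0 < 1 / (n * κ) := by positivity
  rw [rho]
  exact ⟨by linarith, by linarith⟩

theorem eps0_pos {κ : ℝ} (h : 1 ≤ κ) : 0 < eps0 κ := by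
  have : 0 < 2 * κ - 1 := by linarith
  rw [eps0]
  positivity

theorem eps0_le_one {κ : ℝ} (h : 1 ≤ κ) : eps0 κ ≤ 1 := by
  rw [eps0, div_le_one (by linarith)]
  linarith

/-- `c_{τ, ε}` is a root of a quadratic equation. -/
theorem cTau_spec {n p τ : ℕ} {κ ε : ℝ} (hn : 0 < n) (hp : 0 < p) (hρ : rho n κ ∈ Set.Ioo (0 : ℝ) 1)
    (hε : 0 < ε) :
    0 < cTau n p τ κ ε ∧
      rho n κ * (2 * cTau n p τ κ ε * sigmaTau n p τ κ ε +
        cTau n p τ κ ε ^ 2 * (sigmaTau n p τ κ ε + n * √p)) = (1 - rho n κ ^ (τ + 1)) * ε := by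
  obtain ⟨h0, h1⟩ := hρ
  have hq : 0 < n * √(p : ℝ) := by positivity
  have hs : 0 < sigmaTau n p τ κ ε := by
    rw [sigmaTau]
    positivity
  have hY : 0 < (1 - rho n κ ^ (τ + 1)) * ε :=
    mul_pos (sub_pos.2 (pow_lt_one₀ h0.le h1 (Nat.succ_ne_zero _))) hε
  have hc : cTau n p τ κ ε = (-sigmaTau n p τ κ ε +
      √(sigmaTau n p τ κ ε ^ 2 + (sigmaTau n p τ κ ε + n * √p) *
        ((1 - rho n κ ^ (τ + 1)) * ε) / rho n κ)) / (sigmaTau n p τ κ ε + n * √p) := by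
    have : rho n κ * sigmaTau n p τ κ ε ^ 2 +
        (sigmaTau n p τ κ ε + n * √p) * (1 - rho n κ ^ (τ + 1)) * ε =
        rho n κ * (sigmaTau n p τ κ ε ^ 2 + (sigmaTau n p τ κ ε + n * √p) *
          ((1 - rho n κ ^ (τ + 1)) * ε) / rho n κ) := by
      field_simp
    rw [cTau, this, Real.sqrt_mul h0.le,
      mul_div_mul_left _ _ (Real.sqrt_pos.2 h0).ne', add_div, neg_div]
  generalize sigmaTau n p τ κ ε = s at *
  generalize n * √(p : ℝ) = q at *
  generalize (1 - rho n κ ^ (τ + 1)) * ε = Y at *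
  generalize cTau n p τ κ ε = c at *
  generalize rho n κ = ρ at *
  have hsq : 0 < s + q := by linarith
  have hZ : 0 < (s + q) * Y / ρ := by positivity
  have hR : √(s ^ 2 + (s + q) * Y / ρ) ^ 2 = s ^ 2 + (s + q) * Y / ρ :=
    Real.sq_sqrt (by positivity)
  have hlt : s < √(s ^ 2 + (s + q) * Y / ρ) := Real.lt_sqrt_of_sq_lt (by linarith)
  generalize √(s ^ 2 + (s + q) * Y / ρ) = R at *
  refine ⟨by rw [hc]; exact div_pos (by linarith) hsq, ?_⟩
  -- Inverting the quadratic formula: squaring this relation gives the equation for `c`, multiplied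
  -- by `s + q`.
  have hcR : R = s + c * (s + q) := by
    rw [hc]
    field_simp
    ring
  rw [hcR] at hR
  have h2 : (s + q) * (ρ * (2 * c * s + c ^ 2 * (s + q))) = (s + q) * Y := by
    have h3 : ρ * ((s + q) * Y / ρ) = (s + q) * Y := by field_simp
    rw [← h3]
    linear_combination ρ * hR
  exact mul_left_cancel₀ hsq.ne' h2

/-- The `ℓ²` bound on `a` gives `a i ≤ c` in the terms with `σ` and, by Cauchy–Schwarz, `∑ a i ≤ √p
c` in the drift term; this is the origin of `√p`. -/
theorem sum_rescaled_le {n p : ℕ} {ρ ρτ c : ℝ} (hρ : 0 ≤ ρ) (hρτ : 0 ≤ ρτ) (hc : 0 ≤ c)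
    {σ a : Fin p → ℝ} (hσ : ∀ i, 0 ≤ σ i) (ha : ∀ i, 0 ≤ a i) (hac : ∑ i, a i ^ 2 ≤ c ^ 2) :
    ∑ i, ρ * ((1 + a i) ^ 2 * (ρτ * σ i + n) - n) ≤
      ρ * ((1 + c) ^ 2 * (ρτ * ∑ i, σ i) + n * (2 * (√p * c) + c ^ 2)) := by
  rw [← Finset.mul_sum]
  refine mul_le_mul_of_nonneg_left ?_ hρ
  have h1 : ∀ i, a i ≤ c := fun i => le_of_sq_le_sq
    ((Finset.single_le_sum (fun j _ => sq_nonneg (a j)) (Finset.mem_univ i)).trans hac) hc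
  have h2 : ∑ i, a i ≤ √p * c := by
    refine le_of_sq_le_sq ?_ (by positivity)
    rw [mul_pow, Real.sq_sqrt (Nat.cast_nonneg p)]
    have := sq_sum_le_card_mul_sum_sq (s := Finset.univ) (f := a)
    rw [Finset.card_univ, Fintype.card_fin] at this
    exact this.trans (mul_le_mul_of_nonneg_left hac (Nat.cast_nonneg p))
  have h3 : ∀ i, (1 + a i) ^ 2 * (ρτ * σ i + n) - n ≤
      (1 + c) ^ 2 * (ρτ * σ i) + n * (2 * a i + a i ^ 2) := by
    intro i
    have h4 : (1 + a i) ^ 2 ≤ (1 + c) ^ 2 :=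
      pow_le_pow_left₀ (by linarith [ha i]) (by linarith [h1 i]) 2
    have h5 := mul_le_mul_of_nonneg_right h4 (mul_nonneg hρτ (hσ i))
    linarith
  refine (Finset.sum_le_sum fun i _ => h3 i).trans ?_
  rw [Finset.sum_add_distrib, ← Finset.mul_sum, ← Finset.mul_sum, ← Finset.mul_sum,
    Finset.sum_add_distrib, ← Finset.mul_sum]
  have hn : (0 : ℝ) ≤ n := Nat.cast_nonneg n
  gcongr

/-- The bound on `Δ` is invariant if the steps are controlled by `c_{τ, ε}`. -/
theorem rescaled_le_of_cTau {n p τ : ℕ} {κ ε : ℝ} (hn : 0 < n) (hp : 0 < p)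
    (hρ : rho n κ ∈ Set.Ioo (0 : ℝ) 1) (hε : 0 < ε) {Δ : ℝ} (hΔ : Δ ≤ ε) :
    rho n κ * ((1 + cTau n p τ κ ε) ^ 2 * (rho n κ ^ τ * Δ) +
      n * (2 * (√p * cTau n p τ κ ε) + cTau n p τ κ ε ^ 2)) ≤ ε := by
  obtain ⟨hc, h⟩ := cTau_spec (τ := τ) hn hp hρ hε
  have hn' : (0 : ℝ) ≤ n := Nat.cast_nonneg n
  have hsp : 1 ≤ √(p : ℝ) := Real.one_le_sqrt.2 (by exact_mod_cast hp)
  have hρτ : 0 ≤ rho n κ ^ τ := pow_nonneg hρ.1.le τ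
  have hs : sigmaTau n p τ κ ε = rho n κ ^ τ * ε + n * √p := rfl
  generalize cTau n p τ κ ε = c at *
  rw [pow_succ (rho n κ) τ, hs] at h
  generalize rho n κ ^ τ = ρτ at *
  have h1 : (1 + c) ^ 2 * (ρτ * Δ) ≤ (1 + c) ^ 2 * (ρτ * ε) := by gcongr
  have h2 : n * c ^ 2 ≤ c ^ 2 * (n * √(p : ℝ)) := by
    calc n * c ^ 2 = c ^ 2 * (n * 1) := by ring
      _ ≤ _ := by gcongr
  have h3 : 0 ≤ c ^ 2 * (n * √(p : ℝ)) := by positivity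
  have h4 : (1 + c) ^ 2 * (ρτ * Δ) + n * (2 * (√p * c) + c ^ 2) ≤
      ρτ * ε + (2 * c * (ρτ * ε + n * √p) + c ^ 2 * (ρτ * ε + n * √p + n * √p)) := by
    linarith
  -- After multiplication by `ρ`, the equation for `c` turns the right side into `ρ^{τ+1} ε + (1 -
  -- ρ^{τ+1}) ε = ε`.
  have h5 := mul_le_mul_of_nonneg_left h4 hρ.1.le
  linarith

/-- The two regimes of the adaptive stepsize `min {a, 1 / (4 b), 1}`. -/
theorem adaptive_step_bounds {a b b' : ℝ} (ha : 0 ≤ a) (hb : 0 ≤ b) (hab : 0 < b → 0 < a)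
    (h : b' ≤ (1 - min a (min (1 / (4 * b)) 1) / 2) * b + min a (min (1 / (4 * b)) 1) ^ 2 * b ^ 2) :
    (1 / (4 * min a 1) < b → b' ≤ b - 1 / 16) ∧
      (¬ 1 / (4 * min a 1) < b → b' ≤ (1 - min a 1 / 4) * b) := by
  have hm0 : 0 ≤ min a 1 := le_min ha zero_le_one
  rw [min_left_comm] at h
  -- At `b = 0` the quotient `1 / (4 b)` is `0` and `a` may be `0`; both regimes are then immediate.
  rcases hb.eq_or_lt with rfl | hb
  · refine ⟨fun h1 => absurd h1 (not_lt.2 (by positivity)), fun _ => ?_⟩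
    simpa using h
  have hm : 0 < min a 1 := lt_min (hab hb) zero_lt_one
  generalize min a 1 = m at *
  refine ⟨fun h1 => ?_, fun h1 => ?_⟩
  · rw [div_lt_iff₀ (by positivity)] at h1
    have h2 : 1 / (4 * b) ≤ m := by
      rw [div_le_iff₀ (by positivity)]
      linarith
    rw [min_eq_left h2] at h
    have h3 : (1 - 1 / (4 * b) / 2) * b + (1 / (4 * b)) ^ 2 * b ^ 2 = b - 1 / 16 := by
      field_simp
      ring
    linarith
  · rw [not_lt, le_div_iff₀ (by positivity)] at h1
    have h2 : m ≤ 1 / (4 * b) := by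
      rw [le_div_iff₀ (by positivity)]
      linarith
    rw [min_eq_right h2] at h
    -- Here `m b ≤ 1/4`, so `m² b² ≤ m b / 4` takes back half of the decrease `m b / 2`.
    nlinarith [mul_pos hm hb]

/-- The potential `Δ + 4 n m` decreases geometrically. -/
theorem potential_bound {n τ : ℕ} {ρ : ℝ} (hn : 2 ≤ n) (hρ : 1 / 2 ≤ ρ) {Δ m : ℕ → ℝ}
    (hΔ : ∀ k, 0 ≤ Δ k) (hm : ∀ k, 0 ≤ m k)
    (hm1 : ∀ k, m (k + 1) ≤ 3 / 4 * m k)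
    (hm2 : ∀ k, m (k + 1) ≤ (1 + m k / 2) * (Δ k + m k / 2) * m k)
    (hΔ1 : ∀ k, Δ (k + 1) ≤
      ρ * ((1 + m k) ^ 2 * (ρ ^ τ * Δ k) + n * (2 * m k + m k ^ 2)))
    (hm0 : m 0 ≤ Real.log 2 / (8 * (6 * n + 1))) (k : ℕ) :
    Δ k + 4 * n * m k ≤
      max (ρ ^ (τ + 1)) (3 / 4 * ρ) ^ k * (2 * (Δ 0 + 4 * n * m 0)) := by
  set θ := max (ρ ^ (τ + 1)) (3 / 4 * ρ) with hθ
  have hθ1 : ρ ^ (τ + 1) ≤ θ := le_max_left _ _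
  have hθ2 : 3 / 4 * ρ ≤ θ := le_max_right _ _
  have hθ0 : 0 ≤ θ := by linarith
  have hn' : (2 : ℝ) ≤ n := by exact_mod_cast hn
  have hmle : ∀ k, m k ≤ m 0 := by
    intro k
    induction k with
    | zero => exact le_rfl
    | succ k ih => linarith [hm1 k, hm k]
  have hsmall : ∀ k, m k ≤ 1 / 100 := by
    intro k
    refine (hmle k).trans (hm0.trans ?_)
    rw [div_le_iff₀ (by positivity)]
    have := Real.log_two_lt_d9
    linarith
  have hstep : ∀ k, Δ (k + 1) + 4 * n * m (k + 1) ≤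
      θ * (1 + (12 * n + 2) * m k) * (Δ k + 4 * n * m k) := by
    intro k
    have a0 := hm k
    have a1 := hsmall k
    have d0 := hΔ k
    have b1 := hΔ1 k
    have b2 : 4 * n * m (k + 1) ≤ 4 * n * ((1 + m k / 2) * (Δ k + m k / 2) * m k) :=
      mul_le_mul_of_nonneg_left (hm2 k) (by positivity)
    generalize m k = a at *
    generalize Δ k = d at *
    have e1 : ρ * ρ ^ τ * ((1 + a) ^ 2 * d) ≤ θ * ((1 + a) ^ 2 * d) := by
      refine mul_le_mul_of_nonneg_right ?_ (by positivity)
      rwa [← pow_succ']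
    -- The coefficient of `a d`: the right side is what `1 + (12n + 2) a` leaves after `(1 + a)²` is
    -- removed. Here `θ ≥ 3ρ/4 ≥ 3/8`, and `3/8 · 12n` exceeds `4n` with room for small `a`.
    have e2 : 4 * n * (1 + a / 2) ≤ θ * (12 * n - a) := by
      calc 4 * n * (1 + a / 2) ≤ 3 / 8 * (12 * n - a) := by nlinarith
        _ ≤ _ := mul_le_mul_of_nonneg_right (by linarith) (by linarith)
    have e3 : 4 * n * (1 + a / 2) * (a * d) ≤ θ * (12 * n - a) * (a * d) :=
      mul_le_mul_of_nonneg_right e2 (by positivity)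
    -- The weight `4n` is large enough that the drift `2 n ρ a` is absorbed: `4θ ≥ 3ρ`, leaving a
    -- margin of at least `1/2` for the terms in `a`.
    have e4 : ρ * (2 + a) + 2 * a * (1 + a / 2) ≤ 4 * θ := by nlinarith
    have e5 : (ρ * (2 + a) + 2 * a * (1 + a / 2)) * (n * a) ≤ 4 * θ * (n * a) :=
      mul_le_mul_of_nonneg_right e4 (by positivity)
    have e6 : 0 ≤ θ * ((12 * n + 2) * a) * (4 * n * a) := by positivity
    linarith
  -- The linear rate `3/4` gives `m k ≤ 4 (m k - m (k + 1))`, so the exponents telescope.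
  have hexp : ∀ k, Δ k + 4 * n * m k ≤
      θ ^ k * (Real.exp ((12 * n + 2) * (4 * m 0 - 4 * m k)) * (Δ 0 + 4 * n * m 0)) := by
    intro k
    induction k with
    | zero => simp
    | succ k ih =>
      have hP0 : 0 ≤ Δ 0 + 4 * n * m 0 := by
        have := hΔ 0
        have := hm 0
        positivity
      have h1 : 1 + (12 * n + 2) * m k ≤ Real.exp ((12 * n + 2) * m k) := by
        linarith [Real.add_one_le_exp ((12 * n + 2) * m k)]
      have hk := hm k
      calc Δ (k + 1) + 4 * n * m (k + 1)
          ≤ θ * (1 + (12 * n + 2) * m k) * (Δ k + 4 * n * m k) := hstep k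
        _ ≤ θ * Real.exp ((12 * n + 2) * m k) * (θ ^ k *
              (Real.exp ((12 * n + 2) * (4 * m 0 - 4 * m k)) * (Δ 0 + 4 * n * m 0))) := by
            have := hΔ k
            gcongr
        _ = θ ^ (k + 1) * (Real.exp ((12 * n + 2) * m k + (12 * n + 2) * (4 * m 0 - 4 * m k)) *
              (Δ 0 + 4 * n * m 0)) := by
            rw [Real.exp_add]
            ring
        _ ≤ _ := by
            gcongr
            rw [← mul_add]
            refine mul_le_mul_of_nonneg_left ?_ (by positivity)
            linarith [hm1 k]
  refine (hexp k).trans ?_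
  -- The threshold on `m 0` says exactly `4 (12n + 2) m 0 ≤ ln 2`.
  have h2 : Real.exp ((12 * n + 2) * (4 * m 0 - 4 * m k)) ≤ 2 := by
    rw [← Real.le_log_iff_exp_le two_pos]
    rw [le_div_iff₀ (by positivity)] at hm0
    have := hm k
    nlinarith
  have := hΔ 0
  have := hm 0
  gcongr

end Scalars

/-! ### Invariants of a run and global convergence. -/

section Run

open Matrix

variable {n p τ : ℕ} {μ ω L M : ℝ} {f : Fin p → E n → ℝ} {x : ℕ → E n} {G : ℕ → Fin p → Mat n}

theorem dualNorm_pos {K : Mat n} (hK : K.PosDef) {g : E n} (hg : g ≠ 0) : 0 < dualNorm K g :=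
  Real.sqrt_pos.2 (by
    rw [inner_act]
    exact (posDef_iff_dotProduct.1 hK.inv).2 _ fun h => hg (WithLp.ofLp_injective 2 h))

/-- The standing assumptions on the parameters and on the objective. -/
structure Setting (n p : ℕ) (μ ω L M : ℝ) (f : Fin p → E n → ℝ) : Prop where
  p_pos : 0 < p
  μ_pos : 0 < μ
  L_pos : 0 < L
  M_pos : 0 < M
  one_lt : 1 < n * (ω / μ)
  regular : ∀ i, Regular μ ω L (f i)
  concordant : ∀ i, StronglySelfConcordant M (f i)

/-- `G_i` dominates `∇²fᵢ(x)` for every `i`, with total error at most `ε₀`. -/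
structure Approximates (μ ω : ℝ) (f : Fin p → E n → ℝ) (x : E n) (G : Fin p → Mat n) : Prop where
  le : ∀ i, Loewner (hess (f i) x) (G i)
  delta_le : Delta (fun i => hess (f i) x) G ≤ eps0 (ω / μ)

namespace Setting

theorem n_pos (S : Setting n p μ ω L M f) : 0 < n := by
  rcases Nat.eq_zero_or_pos n with h | h
  · have := S.one_lt
    rw [h] at this
    norm_num at this
  · exact h

theorem field (S : Setting n p μ ω L M f) (i : Fin p) :
    IsHessianField μ ω L M (gradient (f i)) (hess (f i)) :=
  (S.regular i).isHessianField (S.concordant i)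

theorem total (S : Setting n p μ ω L M f) :
    IsHessianField (p * μ) (p * ω) (p * L) M (gradient (total f)) (hess (total f)) :=
  isHessianField_total S.μ_pos S.M_pos.le S.regular S.concordant

theorem one_le_kappa (S : Setting n p μ ω L M f) : 1 ≤ ω / μ := by
  have hb := (S.field ⟨0, S.p_pos⟩).bounds 0
  have h := hb.lower.dotProduct_le (unitVec ⟨0, S.n_pos⟩)
  rw [← quad_eq_dotProduct, ← quad_eq_dotProduct, quad_unitVec, quad_unitVec] at h
  rw [one_le_div S.μ_pos]
  have := hb.diag_le ⟨0, S.n_pos⟩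
  simp only [Matrix.smul_apply, one_apply_eq, smul_eq_mul, mul_one] at h
  linarith

theorem rho_mem (S : Setting n p μ ω L M f) : rho n (ω / μ) ∈ Set.Ioo (0 : ℝ) 1 :=
  rho_mem_Ioo S.one_lt

theorem pμ_pos (S : Setting n p μ ω L M f) : 0 < p * μ :=
  mul_pos (Nat.cast_pos.2 S.p_pos) S.μ_pos

theorem cTau_pos (S : Setting n p μ ω L M f) (τ : ℕ) :
    0 < cTau n p τ (ω / μ) (eps0 (ω / μ)) :=
  (cTau_spec S.n_pos S.p_pos S.rho_mem (eps0_pos S.one_le_kappa)).1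

theorem hess_total (S : Setting n p μ ω L M f) (y : E n) :
    hess (DAGQN.total f) y = ∑ i, hess (f i) y :=
  DAGQN.hess_total (fun i => (S.regular i).differentiable)
    (fun i => (S.regular i).differentiable_gradient) y

theorem loewner_total (S : Setting n p μ ω L M f) {y : E n} {K : Fin p → Mat n}
    (h : ∀ i, Loewner (hess (f i) y) (K i)) : Loewner (hess (DAGQN.total f) y) (∑ i, K i) := by
  rw [S.hess_total]
  exact Loewner.sum h

theorem sigma_nonneg (S : Setting n p μ ω L M f) {y : E n} {K : Fin p → Mat n}
    (h : ∀ i, Loewner (hess (f i) y) (K i)) (i : Fin p) : 0 ≤ sigma (hess (f i) y) (K i) :=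
  DAGQN.sigma_nonneg ((S.field i).posDef S.μ_pos y) (h i)

theorem Delta_nonneg (S : Setting n p μ ω L M f) {y : E n} {K : Fin p → Mat n}
    (h : ∀ i, Loewner (hess (f i) y) (K i)) : 0 ≤ Delta (fun i => hess (f i) y) K :=
  Finset.sum_nonneg fun i _ => S.sigma_nonneg h i

/-- For each worker the error is at most `σᵢ Aᵢ ⪯ Δ Aᵢ`; then sum over workers. -/
theorem sub_le_Delta (S : Setting n p μ ω L M f) {y : E n} {K : Fin p → Mat n}
    (h : ∀ i, Loewner (hess (f i) y) (K i)) (v : Fin n → ℝ) :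
    v ⬝ᵥ (∑ i, K i - hess (DAGQN.total f) y) *ᵥ v ≤
      Delta (fun i => hess (f i) y) K * (v ⬝ᵥ hess (DAGQN.total f) y *ᵥ v) := by
  rw [S.hess_total, ← Finset.sum_sub_distrib, dotProduct_sum_mulVec, dotProduct_sum_mulVec,
    Finset.mul_sum]
  refine Finset.sum_le_sum fun i _ =>
    (dotProduct_le_trace_mul ((S.field i).posDef S.μ_pos y) (h i) v).trans
      (mul_le_mul_of_nonneg_right ?_
        (dotProduct_mulVec_nonneg ((S.field i).posDef S.μ_pos y).posSemidef v))
  exact Finset.single_le_sum (f := fun i => sigma (hess (f i) y) (K i))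
    (fun j _ => S.sigma_nonneg h j) (Finset.mem_univ i)

/-- One round of all workers. -/
theorem round_bounds (S : Setting n p μ ω L M f) (hrun : IsRun τ μ ω L M f x G) {k : ℕ}
    (h : ∀ i, Loewner (hess (f i) (x k)) (G k i)) {c : ℝ} (hc : 0 ≤ c)
    (hxc : M * wnorm (hess (DAGQN.total f) (x k)) (x (k + 1) - x k) ≤ c) :
    (∀ i, Loewner (hess (f i) (x (k + 1))) (G (k + 1) i)) ∧
      Delta (fun i => hess (f i) (x (k + 1))) (G (k + 1)) ≤
        rho n (ω / μ) * ((1 + c) ^ 2 *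
          (rho n (ω / μ) ^ τ * Delta (fun i => hess (f i) (x k)) (G k)) +
            n * (2 * (√p * c) + c ^ 2)) := by
  have hρ := S.rho_mem.1.le
  have hM := S.M_pos.le
  set a : Fin p → ℝ := fun i => M * wnorm (hess (f i) (x k)) (x (k + 1) - x k) with ha
  have ha0 : ∀ i, 0 ≤ a i := fun i => mul_nonneg hM (wnorm_nonneg _ _)
  have hpd : ∀ i y, (hess (f i) y).PosDef := fun i y => (S.field i).posDef S.μ_pos y
  have hw : ∀ i, Loewner (hess (f i) (x (k + 1))) (G (k + 1) i) ∧
      sigma (hess (f i) (x (k + 1))) (G (k + 1) i) ≤ rho n (ω / μ) *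
        ((1 + a i) ^ 2 * (rho n (ω / μ) ^ τ * sigma (hess (f i) (x k)) (G k i) + n) - n) := by
    intro i
    obtain ⟨H, hH, hG'⟩ := hrun.estimate k i
    refine worker_bounds S.μ_pos (zero_lt_one.trans S.one_lt) hρ ((S.field i).bounds _)
      ((S.field i).bounds _) (by linarith [ha0 i]) (fun v => ?_) (fun v => ?_) (h i) hH hG'
    · have := (S.field i).concordant (x (k + 1)) (x k) (x k) (x (k + 1)) v
      rw [← neg_sub (x (k + 1)), wnorm_neg, sub_mulVec, dotProduct_sub] at this
      simp only [ha]
      linarith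
    · have := (S.field i).concordant (x k) (x (k + 1)) (x k) (x k) v
      rw [sub_mulVec, dotProduct_sub] at this
      simp only [ha]
      linarith
  refine ⟨fun i => (hw i).1, (Finset.sum_le_sum fun i _ => (hw i).2).trans ?_⟩
  refine sum_rescaled_le hρ (pow_nonneg hρ τ) hc (fun i => S.sigma_nonneg h i) ha0 ?_
  -- Squared local norms add up to the squared norm of the total Hessian, so one global bound on the
  -- displacement serves all workers.
  have hsum : ∑ i, a i ^ 2 = (M * wnorm (hess (DAGQN.total f) (x k)) (x (k + 1) - x k)) ^ 2 := by
    rw [mul_pow, wnorm_sq (S.total.posDef S.pμ_pos _).posSemidef, S.hess_total,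
      dotProduct_sum_mulVec, Finset.mul_sum]
    refine Finset.sum_congr rfl fun i _ => ?_
    rw [ha, mul_pow, wnorm_sq (hpd i _).posSemidef]
  rw [hsum]
  exact pow_le_pow_left₀ (mul_nonneg hM (wnorm_nonneg _ _)) hxc 2

theorem alphaTau_nonneg (S : Setting n p μ ω L M f) (τ : ℕ) (K : Mat n) (y : E n) :
    0 ≤ alphaTau τ μ ω M f K y :=
  div_nonneg (S.cTau_pos τ).le (mul_nonneg S.M_pos.le (dualNorm_nonneg _ _))

theorem beta_nonneg (S : Setting n p μ ω L M f) (y : E n) : 0 ≤ beta μ L f y := by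
  have := S.L_pos
  rw [beta]
  positivity

theorem stepSize_nonneg (S : Setting n p μ ω L M f) (τ : ℕ) (K : Mat n) (y : E n) :
    0 ≤ stepSize τ μ ω L M f K y :=
  le_min (S.alphaTau_nonneg τ K y)
    (le_min (div_nonneg zero_le_one (mul_nonneg zero_le_four (S.beta_nonneg y))) zero_le_one)

theorem stepSize_le_one (K : Mat n) (y : E n) : stepSize τ μ ω L M f K y ≤ 1 :=
  (min_le_right _ _).trans (min_le_right _ _)

/-- Since `A ⪯ G`, the `A`-norm of `G⁻¹ g` is at most `‖g‖_G^*`, the quantity in the denominator of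
`α_τ`. A zero denominator causes no trouble, as the displacement bound is then zero. -/
theorem displacement_le (S : Setting n p μ ω L M f) (hrun : IsRun τ μ ω L M f x G) {k : ℕ}
    (h : ∀ i, Loewner (hess (f i) (x k)) (G k i)) :
    M * wnorm (hess (DAGQN.total f) (x k)) (x (k + 1) - x k) ≤
      cTau n p τ (ω / μ) (eps0 (ω / μ)) := by
  have hM := S.M_pos
  have hA := S.total.posDef S.pμ_pos (x k)
  have hα := S.stepSize_nonneg τ (∑ i, G k i) (x k)
  have h1 : stepSize τ μ ω L M f (∑ i, G k i) (x k) ≤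
      cTau n p τ (ω / μ) (eps0 (ω / μ)) /
        (M * dualNorm (∑ i, G k i) (gradient (DAGQN.total f) (x k))) := min_le_left _ _
  rw [hrun.iterate, sub_sub_cancel_left, wnorm_neg, wnorm_smul, abs_of_nonneg hα]
  have h2 := wnorm_act_inv_le hA (S.loewner_total h) (gradient (DAGQN.total f) (x k))
  calc M * (stepSize τ μ ω L M f (∑ i, G k i) (x k) * _)
      ≤ M * (stepSize τ μ ω L M f (∑ i, G k i) (x k) *
          dualNorm (∑ i, G k i) (gradient (DAGQN.total f) (x k))) := by gcongr
    _ = stepSize τ μ ω L M f (∑ i, G k i) (x k) *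
          (M * dualNorm (∑ i, G k i) (gradient (DAGQN.total f) (x k))) := by ring
    _ ≤ _ := mul_le_of_le_div₀ (S.cTau_pos τ).le (mul_nonneg hM.le (dualNorm_nonneg _ _)) h1

theorem approximates (S : Setting n p μ ω L M f) (hrun : IsRun τ μ ω L M f x G)
    (h0 : Approximates μ ω f (x 0) (G 0)) (k : ℕ) : Approximates μ ω f (x k) (G k) := by
  induction k with
  | zero => exact h0
  | succ k ih =>
    obtain ⟨h1, h2⟩ := S.round_bounds hrun ih.le (S.cTau_pos τ).le (S.displacement_le hrun ih.le)
    exact ⟨h1, h2.trans (rescaled_le_of_cTau S.n_pos S.p_pos S.rho_mem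
      (eps0_pos S.one_le_kappa) ih.delta_le)⟩

theorem sub_le_eps0 (S : Setting n p μ ω L M f) {y : E n} {K : Fin p → Mat n}
    (h : Approximates μ ω f y K) (v : Fin n → ℝ) :
    v ⬝ᵥ (∑ i, K i - hess (DAGQN.total f) y) *ᵥ v ≤
      eps0 (ω / μ) * (v ⬝ᵥ hess (DAGQN.total f) y *ᵥ v) :=
  (S.sub_le_Delta h.le v).trans (mul_le_mul_of_nonneg_right h.delta_le
    (dotProduct_mulVec_nonneg (S.total.posDef S.pμ_pos y).posSemidef v))

/-- The normalization of `β` is the one for which the remainder becomes exactly `α² β²`. -/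
theorem beta_succ_le (S : Setting n p μ ω L M f) (hrun : IsRun τ μ ω L M f x G) {k : ℕ}
    (h : Approximates μ ω f (x k) (G k)) :
    beta μ L f (x (k + 1)) ≤
      (1 - stepSize τ μ ω L M f (∑ i, G k i) (x k) / 2) * beta μ L f (x k) +
        stepSize τ μ ω L M f (∑ i, G k i) (x k) ^ 2 * beta μ L f (x k) ^ 2 := by
  have hL := S.L_pos
  have hμ := S.μ_pos
  have hp : (0 : ℝ) < p := Nat.cast_pos.2 S.p_pos
  have hT := S.total
  have hω : (p : ℝ) * ω = ω / μ * (p * μ) := by field_simp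
  rw [hω] at hT
  have := hT.norm_step_le S.pμ_pos S.one_le_kappa (by positivity) (x k) (S.loewner_total h.le)
    (S.sub_le_eps0 h) (S.stepSize_nonneg τ (∑ i, G k i) (x k)) (stepSize_le_one _ _)
  rw [← hrun.iterate] at this
  simp only [beta]
  generalize stepSize τ μ ω L M f (∑ i, G k i) (x k) = α at *
  generalize ‖gradient (DAGQN.total f) (x k)‖ = N at *
  generalize ‖gradient (DAGQN.total f) (x (k + 1))‖ = N' at *
  calc L * N' / (2 * p * μ ^ 2) ≤
        L * ((1 - α / 2) * N + p * L / 2 * (α ^ 2 * (N / (p * μ)) ^ 2)) / (2 * p * μ ^ 2) := by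
        gcongr
    _ = _ := by field_simp

theorem global_bounds (S : Setting n p μ ω L M f) (hrun : IsRun τ μ ω L M f x G) {k : ℕ}
    (h : Approximates μ ω f (x k) (G k)) :
    (1 / (4 * alphaBar τ μ ω M f (∑ i, G k i) (x k)) < beta μ L f (x k) →
        beta μ L f (x (k + 1)) ≤ beta μ L f (x k) - 1 / 16) ∧
      (¬ 1 / (4 * alphaBar τ μ ω M f (∑ i, G k i) (x k)) < beta μ L f (x k) →
        beta μ L f (x (k + 1)) ≤
          (1 - alphaBar τ μ ω M f (∑ i, G k i) (x k) / 4) * beta μ L f (x k)) := by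
  refine adaptive_step_bounds (S.alphaTau_nonneg τ _ _) (S.beta_nonneg _) (fun hb => ?_)
    (S.beta_succ_le hrun h)
  have hg : gradient (DAGQN.total f) (x k) ≠ 0 := by
    intro h0
    rw [beta, h0] at hb
    simp at hb
  have hG := (S.loewner_total h.le).posDef (S.total.posDef S.pμ_pos (x k))
  have hdual := dualNorm_pos hG hg
  exact div_pos (S.cTau_pos τ) (mul_pos S.M_pos hdual)

/-- Both regimes decrease `β`, which is proportional to the gradient norm, so the local region is
invariant. -/
theorem norm_gradient_succ_le (S : Setting n p μ ω L M f) (hrun : IsRun τ μ ω L M f x G) {k : ℕ}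
    (h : Approximates μ ω f (x k) (G k)) :
    ‖gradient (DAGQN.total f) (x (k + 1))‖ ≤ ‖gradient (DAGQN.total f) (x k)‖ := by
  have hβ : beta μ L f (x (k + 1)) ≤ beta μ L f (x k) := by
    obtain ⟨h1, h2⟩ := S.global_bounds hrun h
    by_cases hc : 1 / (4 * alphaBar τ μ ω M f (∑ i, G k i) (x k)) < beta μ L f (x k)
    · linarith [h1 hc]
    · have h3 : 0 ≤ alphaBar τ μ ω M f (∑ i, G k i) (x k) :=
        le_min (S.alphaTau_nonneg τ _ _) zero_le_one
      nlinarith [h2 hc, mul_nonneg h3 (S.beta_nonneg (x k))]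
  have hp : (0 : ℝ) < p := Nat.cast_pos.2 S.p_pos
  have hμ := S.μ_pos
  rw [beta, beta, div_le_div_iff_of_pos_right (by positivity)] at hβ
  exact le_of_mul_le_mul_left hβ S.L_pos

/-- Near the solution the stepsize is one. -/
theorem iterate_eq (S : Setting n p μ ω L M f) (hrun : IsRun τ μ ω L M f x G)
    (h0 : Approximates μ ω f (x 0) (G 0))
    (hg : ‖gradient (DAGQN.total f) (x 0)‖ ≤
      min (√(p * μ) * cTau n p τ (ω / μ) (eps0 (ω / μ)) / M) (p * μ ^ 2 / (2 * L))) (k : ℕ) :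
    x (k + 1) = x k - act (∑ i, G k i)⁻¹ (gradient (DAGQN.total f) (x k)) := by
  have hk : ‖gradient (DAGQN.total f) (x k)‖ ≤
      min (√(p * μ) * cTau n p τ (ω / μ) (eps0 (ω / μ)) / M) (p * μ ^ 2 / (2 * L)) := by
    induction k with
    | zero => exact hg
    | succ k ih => exact (S.norm_gradient_succ_le hrun (S.approximates hrun h0 k)).trans ih
  have hS := S.approximates hrun h0 k
  rw [hrun.iterate]
  -- For a zero gradient the stepsize is `0` rather than `1`, but the direction vanishes as well.
  by_cases hz : gradient (DAGQN.total f) (x k) = 0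
  · rw [hz, act_zero, smul_zero]
  have hL := S.L_pos
  have hM := S.M_pos
  have hμ := S.μ_pos
  have hp : (0 : ℝ) < p := Nat.cast_pos.2 S.p_pos
  have hβ0 := (S.beta_nonneg (x k)).lt_of_ne fun h => by
    have hN : ‖gradient (DAGQN.total f) (x k)‖ ≠ 0 := norm_ne_zero_iff.2 hz
    rw [beta, eq_comm, div_eq_zero_iff] at h
    rcases h with h | h
    · exact (mul_ne_zero hL.ne' hN) h
    · exact absurd h (by positivity)
  have hα : stepSize τ μ ω L M f (∑ i, G k i) (x k) = 1 := by
    obtain ⟨h1, h2⟩ := le_min_iff.1 hk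
    rw [le_div_iff₀ (by positivity)] at h1 h2
    refine le_antisymm (stepSize_le_one _ _) (le_min ?_ (le_min ?_ le_rfl))
    · have hα0 : 0 < M * dualNorm (∑ i, G k i) (gradient (DAGQN.total f) (x k)) :=
        mul_pos hM (dualNorm_pos
          ((S.loewner_total hS.le).posDef (S.total.posDef S.pμ_pos (x k))) hz)
      rw [alphaTau, one_le_div hα0]
      have h3 := sqrt_mul_dualNorm_le S.pμ_pos
        ((S.total.bounds (x k)).lower.trans (S.loewner_total hS.le))
        (gradient (DAGQN.total f) (x k))
      have h4 : 0 < √(p * μ) := Real.sqrt_pos.2 S.pμ_pos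
      refine le_of_mul_le_mul_left ?_ h4
      calc √(p * μ) * (M * dualNorm (∑ i, G k i) (gradient (DAGQN.total f) (x k)))
          = √(p * μ) * dualNorm (∑ i, G k i) (gradient (DAGQN.total f) (x k)) * M := by ring
        _ ≤ ‖gradient (DAGQN.total f) (x k)‖ * M := mul_le_mul_of_nonneg_right h3 hM.le
        _ ≤ _ := h1
    -- The second term of the minimum is the condition `β ≤ 1/4`.
    · rw [one_le_div (by positivity), beta, ← mul_div_assoc, div_le_one (by positivity)]
      linarith
  rw [hα, one_smul]

end Setting

end Run

/-! ### Local linear and superlinear convergence. -/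

section Local

open Matrix

variable {n p τ : ℕ} {μ ω L M : ℝ} {f : Fin p → E n → ℝ} {x : ℕ → E n} {G : ℕ → Fin p → Mat n}

theorem lam_nonneg (f : Fin p → E n → ℝ) (y : E n) : 0 ≤ lam f y := dualNorm_nonneg _ _

namespace Setting

theorem one_le_sqrt (S : Setting n p μ ω L M f) : 1 ≤ √(p : ℝ) :=
  Real.one_le_sqrt.2 (by exact_mod_cast S.p_pos)

/-- Replacing `M λ` by `√p M λ` lets the recursions for `λ` and `Δ` share one small parameter. -/
theorem mul_lam_le (S : Setting n p μ ω L M f) (y : E n) : M * lam f y ≤ √p * M * lam f y := by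
  rw [mul_assoc]
  exact le_mul_of_one_le_left (mul_nonneg S.M_pos.le (lam_nonneg f y)) S.one_le_sqrt

/-- A full quasi-Newton step. -/
theorem lam_succ_le (S : Setting n p μ ω L M f) {k : ℕ} (hS : Approximates μ ω f (x k) (G k))
    (hx : x (k + 1) = x k - act (∑ i, G k i)⁻¹ (gradient (DAGQN.total f) (x k))) :
    lam f (x (k + 1)) ≤ (1 + √p * M * lam f (x k) / 2) *
      (Delta (fun i => hess (f i) (x k)) (G k) / (1 + Delta (fun i => hess (f i) (x k)) (G k)) +
        √p * M * lam f (x k) / 2) * lam f (x k) := by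
  have hη := S.Delta_nonneg hS.le
  have h := S.total.dualNorm_step_le S.pμ_pos S.M_pos.le (x k) (S.loewner_total hS.le) hη
    (S.sub_le_Delta hS.le)
  rw [← hx] at h
  have hl := lam_nonneg f (x k)
  have hm := S.mul_lam_le (x k)
  have hm0 : 0 ≤ M * lam f (x k) := mul_nonneg S.M_pos.le hl
  refine h.trans ?_
  change (1 + M * lam f (x k) / 2) * (_ + M * lam f (x k) / 2) * lam f (x k) ≤ _
  have hm1 : 0 ≤ 1 + √p * M * lam f (x k) / 2 := by linarith
  gcongr

theorem lam_succ_le_three_quarters (S : Setting n p μ ω L M f)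
    {k : ℕ} (hS : Approximates μ ω f (x k) (G k))
    (hx : x (k + 1) = x k - act (∑ i, G k i)⁻¹ (gradient (DAGQN.total f) (x k)))
    (hm : √p * M * lam f (x k) ≤ 1 / 4) : lam f (x (k + 1)) ≤ 3 / 4 * lam f (x k) := by
  have hη := S.Delta_nonneg hS.le
  have hη1 := hS.delta_le.trans (eps0_le_one S.one_le_kappa)
  refine (S.lam_succ_le hS hx).trans (mul_le_mul_of_nonneg_right ?_ (lam_nonneg _ _))
  have hm0 : 0 ≤ √p * M * lam f (x k) :=
    mul_nonneg (mul_nonneg (Real.sqrt_nonneg _) S.M_pos.le) (lam_nonneg _ _)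
  have h1 : Delta (fun i => hess (f i) (x k)) (G k) /
      (1 + Delta (fun i => hess (f i) (x k)) (G k)) ≤ 1 / 2 := by
    rw [div_le_iff₀ (by linarith)]
    linarith
  -- The value is `9/8 · 5/8 = 45/64`.
  calc _ ≤ (1 + 1 / 4 / 2) * (1 / 2 + 1 / 4 / 2) := by gcongr
    _ ≤ (3 / 4 : ℝ) := by norm_num

theorem linear_convergence (S : Setting n p μ ω L M f)
    (hS : ∀ k, Approximates μ ω f (x k) (G k))
    (hx : ∀ k, x (k + 1) = x k - act (∑ i, G k i)⁻¹ (gradient (DAGQN.total f) (x k)))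
    (h0 : √p * M * lam f (x 0) ≤ 1 / 4) (k : ℕ) : lam f (x (k + 1)) ≤ 3 / 4 * lam f (x k) := by
  have hc : 0 ≤ √p * M := mul_nonneg (Real.sqrt_nonneg _) S.M_pos.le
  refine S.lam_succ_le_three_quarters (hS k) (hx k) ?_
  induction k with
  | zero => exact h0
  | succ k ih =>
    refine (mul_le_mul_of_nonneg_left ?_ hc).trans ih
    have := S.lam_succ_le_three_quarters (hS k) (hx k) ih
    linarith [lam_nonneg f (x k)]

theorem superlinear_convergence (S : Setting n p μ ω L M f) (hrun : IsRun τ μ ω L M f x G)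
    (hS : ∀ k, Approximates μ ω f (x k) (G k))
    (hx : ∀ k, x (k + 1) = x k - act (∑ i, G k i)⁻¹ (gradient (DAGQN.total f) (x k)))
    (hn : 2 ≤ n) (h0 : √p * M * lam f (x 0) ≤ Real.log 2 / (8 * (6 * n + 1))) (k : ℕ) :
    lam f (x (k + 1)) ≤ max (rho n (ω / μ) ^ (τ + 1)) (3 / 4 * rho n (ω / μ)) ^ k
      * (2 * Phi0 n (ω / μ)) * lam f (x k) := by
  have hn' : (2 : ℝ) ≤ n := by exact_mod_cast hn
  have hc : 0 ≤ √p * M := mul_nonneg (Real.sqrt_nonneg _) S.M_pos.le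
  have hρ : 1 / 2 ≤ rho n (ω / μ) := by
    have h1 : (2 : ℝ) ≤ n * (ω / μ) := by nlinarith [S.one_le_kappa]
    have h2 : 1 / (n * (ω / μ)) ≤ 1 / 2 := one_div_le_one_div_of_le two_pos h1
    rw [rho]
    linarith
  have hquarter : √p * M * lam f (x 0) ≤ 1 / 4 := by
    refine h0.trans ?_
    rw [div_le_iff₀ (by positivity)]
    linarith [Real.log_two_lt_d9]
  have hΔ : ∀ k, 0 ≤ Delta (fun i => hess (f i) (x k)) (G k) := fun k => S.Delta_nonneg (hS k).le
  have hm : ∀ k, 0 ≤ √p * M * lam f (x k) := fun k => mul_nonneg hc (lam_nonneg _ _)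
  have hlin := S.linear_convergence hS hx hquarter
  have hfrac : ∀ k, Delta (fun i => hess (f i) (x k)) (G k) /
      (1 + Delta (fun i => hess (f i) (x k)) (G k)) ≤ Delta (fun i => hess (f i) (x k)) (G k) :=
    fun k => div_le_self (hΔ k) (by linarith [hΔ k])
  have hstep : ∀ k, lam f (x (k + 1)) ≤ (1 + √p * M * lam f (x k) / 2) *
      (Delta (fun i => hess (f i) (x k)) (G k) + √p * M * lam f (x k) / 2) * lam f (x k) := by
    intro k
    refine (S.lam_succ_le (hS k) (hx k)).trans ?_
    have := hm k
    have := lam_nonneg f (x k)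
    gcongr
    exact hfrac k
  have hround : ∀ k, Delta (fun i => hess (f i) (x (k + 1))) (G (k + 1)) ≤
      rho n (ω / μ) * ((1 + √p * M * lam f (x k)) ^ 2 *
        (rho n (ω / μ) ^ τ * Delta (fun i => hess (f i) (x k)) (G k)) +
          n * (2 * (√p * M * lam f (x k)) + (√p * M * lam f (x k)) ^ 2)) := by
    intro k
    have hl := lam_nonneg f (x k)
    have hMl : 0 ≤ M * lam f (x k) := mul_nonneg S.M_pos.le hl
    have hle := S.loewner_total (hS k).le
    -- With a full step, `A ⪯ G` bounds the displacement by `λ`, so the drift of the Hessians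
    -- shrinks with `λ` instead of being merely at most `c_{τ,ε₀}`.
    have hr : M * wnorm (hess (DAGQN.total f) (x k)) (x (k + 1) - x k) ≤ M * lam f (x k) := by
      refine mul_le_mul_of_nonneg_left ?_ S.M_pos.le
      rw [hx, sub_sub_cancel_left, wnorm_neg]
      have hA := S.total.posDef S.pμ_pos (x k)
      exact (wnorm_act_inv_le hA hle _).trans (dualNorm_anti hA hle _)
    refine (S.round_bounds hrun (hS k).le hMl hr).2.trans ?_
    have h1 := S.mul_lam_le (x k)
    have h2 := hΔ k
    have h3 := S.rho_mem.1.le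
    rw [← mul_assoc (√(p : ℝ))]
    gcongr
  have hpot := potential_bound hn hρ hΔ hm
    (fun k => by linarith [mul_le_mul_of_nonneg_left (hlin k) hc])
    (fun k => by linarith [mul_le_mul_of_nonneg_left (hstep k) hc]) hround h0 k
  have hPhi : Delta (fun i => hess (f i) (x 0)) (G 0) + 4 * n * (√p * M * lam f (x 0)) ≤
      Phi0 n (ω / μ) := by
    refine add_le_add (hS 0).delta_le ?_
    calc 4 * n * (√p * M * lam f (x 0)) ≤ 4 * n * (Real.log 2 / (8 * (6 * n + 1))) := by gcongr
      _ = _ := by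
        field_simp
        ring
  refine (hstep k).trans (mul_le_mul_of_nonneg_right ?_ (lam_nonneg _ _))
  have hmk : √p * M * lam f (x k) ≤ 1 / 4 := by
    have : ∀ k, √p * M * lam f (x k) ≤ 1 / 4 := by
      intro k
      induction k with
      | zero => exact hquarter
      | succ k ih => linarith [mul_le_mul_of_nonneg_left (hlin k) hc, hm k]
    exact this k
  have hΔ1 := (hS k).delta_le.trans (eps0_le_one S.one_le_kappa)
  -- The contraction factor of `λ` is itself below the potential, by `Δ ≤ 1`, `m ≤ 1/4` and `n ≥ 2`;
  -- the decay of the potential is therefore the rate.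
  have hle : (1 + √p * M * lam f (x k) / 2) *
      (Delta (fun i => hess (f i) (x k)) (G k) + √p * M * lam f (x k) / 2) ≤
      Delta (fun i => hess (f i) (x k)) (G k) + 4 * n * (√p * M * lam f (x k)) := by
    have h1 := hm k
    generalize √p * M * lam f (x k) = m at *
    generalize Delta (fun i => hess (f i) (x k)) (G k) = d at *
    nlinarith [mul_le_mul_of_nonneg_right hΔ1 h1, mul_le_mul_of_nonneg_right hn' h1]
  refine hle.trans (hpot.trans ?_)
  have hθ : 0 ≤ max (rho n (ω / μ) ^ (τ + 1)) (3 / 4 * rho n (ω / μ)) :=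
    le_max_of_le_right (by linarith)
  gcongr

end Setting

end Local

end DAGQN

theorem mainTheorem1 (n p τ : ℕ) (μ ω L M : ℝ)
    (hp : 1 ≤ p) (hμ : 0 < μ) (hL : 0 < L) (hM : 0 < M) (hnκ : 1 < n * (ω / μ))
    (f : Fin p → E n → ℝ)
    (hf : ∀ i, Regular μ ω L (f i))
    (hsc : ∀ i, StronglySelfConcordant M (f i))
    (x : ℕ → E n) (G : ℕ → Fin p → Mat n)
    (hrun : IsRun τ μ ω L M f x G)
    (hG0 : ∀ i, Loewner (hess (f i) (x 0)) (G 0 i))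
    (hΔ0 : Delta (fun i => hess (f i) (x 0)) (G 0) ≤ eps0 (ω / μ)) :
    (∀ k,
      (1 / (4 * alphaBar τ μ ω M f (∑ i, G k i) (x k)) < beta μ L f (x k) →
        beta μ L f (x (k + 1)) ≤ beta μ L f (x k) - 1 / 16) ∧
      (¬ 1 / (4 * alphaBar τ μ ω M f (∑ i, G k i) (x k)) < beta μ L f (x k) →
        beta μ L f (x (k + 1)) ≤
          (1 - alphaBar τ μ ω M f (∑ i, G k i) (x k) / 4) * beta μ L f (x k))) ∧
    (‖gradient (total f) (x 0)‖ ≤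
        min (√(p * μ) * cTau n p τ (ω / μ) (eps0 (ω / μ)) / M) (p * μ ^ 2 / (2 * L)) →
      (√p * M * lam f (x 0) ≤ 1 / 4 →
        ∀ k, lam f (x (k + 1)) ≤ 3 / 4 * lam f (x k)) ∧
      (2 ≤ n → √p * M * lam f (x 0) ≤ Real.log 2 / (8 * (6 * n + 1)) →
        ∀ k, lam f (x (k + 1)) ≤
          max (rho n (ω / μ) ^ (τ + 1)) (3 / 4 * rho n (ω / μ)) ^ k
            * (2 * Phi0 n (ω / μ)) * lam f (x k))) := by
  have S : Setting n p μ ω L M f := ⟨hp, hμ, hL, hM, hnκ, hf, hsc⟩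
  have h0 : Approximates μ ω f (x 0) (G 0) := ⟨hG0, hΔ0⟩
  have hS := S.approximates hrun h0
  refine ⟨fun k => S.global_bounds hrun (hS k), fun hg => ?_⟩
  have hx := S.iterate_eq hrun h0 hg
  exact ⟨S.linear_convergence hS hx, S.superlinear_convergence hrun hS hx⟩
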